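/- Let $H$ be a nonzero real Hilbert space with a Hilbert basis $(e_i)_{i\in I}$, where $I=\{1,\dots,n\}$ or $I=\mathbb N\setminus\{0\}$. A bounded operator $A$ on $H$ is Hilbert–Schmidt if $\sum_i|Ae_i|^2<\infty$, and then $|A|_{HS}=\big(\sum_i|Ae_i|^2\big)^{1/2}$. Let $SO_{HS}(H)$ be the set of orthogonal operators $Q$ on $H$ ($Q^*Q=QQ^*=\mathrm{Id}$) such that $Q-\mathrm{Id}$ is Hilbert–Schmidt and $\det Q=1$, where $\det Q=\lim_m\det\big(\langle e_i,Qe_j\rangle\big)_{i,j\le m}$ (for $I=\{1,\dots,n\}$ this is the usual determinant). Let $\mathfrak{so}_{HS}(H)$ be the Lie algebra of Hilbert–Schmidt operators $B$ with $B^*=-B$, and let $\mathrm{Exp}$ be the operator exponential. Then $\mathrm{Exp}$ maps $\mathfrak{so}_{HS}(H)$ into $SO_{HS}(H)$, and $\mathrm{Exp}:\mathfrak{so}_{HS}(H)\to SO_{HS}(H)$ is surjective. More precisely, for each $Q\in SO_{HS}(H)$ there exist a set $J\subset\mathbb N$, real numbers $(\theta_j)_{j\in J}$ with $0<\theta_j\le\pi$,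 and operators $(B_j)_{j\in J}$ in $\mathfrak{so}_{HS}(H)$, with $[B_k,B_j]=0$ for $k\ne j$ and $B_j^3=-B_j$, such that the sum $B=\sum_{j\in J}\theta_jB_j$ and the product $\prod_{j\in J}\mathrm{Exp}(\theta_jB_j)$ converge in the Hilbert–Schmidt norm, independently of the order of the terms and factors (for the product: the finite partial products differ from the limit by Hilbert–Schmidt operators whose norms tend to $0$), $B\in\mathfrak{so}_{HS}(H)$, and $$Q=\prod_{j\in J}\mathrm{Exp}(\theta_jB_j)=\mathrm{Exp}\Big(\sum_{j\in J}\theta_jB_j\Big).$$ Moreover, these families may be taken such that each $B_j$ has finite rank $n_j$ and $|B|_{HS}^2=\sum_{j\in J}n_j\theta_j^2$. -/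

import Mathlib

open Filter Topology

section HilbertSchmidt

variable {ι H : Type*} [NormedAddCommGroup H] [InnerProductSpace ℝ H]

/-- `A` is a Hilbert-Schmidt operator: `∑ i, |A e_i|² < ∞` in the Hilbert basis `e`. -/
def IsHilbertSchmidt (e : HilbertBasis ι ℝ H) (A : H →L[ℝ] H) : Prop :=
  Summable fun i => ‖A (e i)‖ ^ 2

/-- The Hilbert-Schmidt norm `|A|_HS = (∑ i, |A e_i|²)^(1/2)` (of a Hilbert-Schmidt operator). -/
noncomputable def hsNorm (e : HilbertBasis ι ℝ H) (A : H →L[ℝ] H) : ℝ :=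
  Real.sqrt (∑' i, ‖A (e i)‖ ^ 2)

/-- `F` converges to `A` along `l` in the Hilbert-Schmidt norm: the differences `F x - A` are
Hilbert-Schmidt and their Hilbert-Schmidt norms tend to `0`. -/
def HSTendsto {α : Type*} (e : HilbertBasis ι ℝ H) (F : α → H →L[ℝ] H) (l : Filter α)
    (A : H →L[ℝ] H) : Prop :=
  (∀ x, IsHilbertSchmidt e (F x - A)) ∧ Tendsto (fun x => hsNorm e (F x - A)) l (𝓝 0)

/-- The determinant of `A` exists and equals `d`: `det A = lim_n det A_n`, where
`A_n = (⟨e_i, A e_j⟩)_{i, j ≤ n}` is the compression of `A` to the span of the `e_i`, `i ≤ n`.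
(The index set is a copy of `{1, …, n}` or of `ℕ`.) -/
def HasHSDet [LinearOrder ι] [LocallyFiniteOrderBot ι] (e : HilbertBasis ι ℝ H)
    (A : H →L[ℝ] H) (d : ℝ) : Prop :=
  Tendsto
    (fun n : ι =>
      (Matrix.of fun i j : ↥(Finset.Iic n) => inner ℝ (e (i : ι)) (A (e (j : ι)))).det)
    atTop (𝓝 d)

variable [CompleteSpace H]

/-- The group `SO_HS(H)`: the orthogonal operators `Q` (`Q* Q = Q Q* = Id`) such that `Q - Id` is
Hilbert-Schmidt and `det Q = 1`. -/
def SOHS [LinearOrder ι] [LocallyFiniteOrderBot ι] (e : HilbertBasis ι ℝ H) :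
    Set (H →L[ℝ] H) :=
  {Q | Q ∈ unitary (H →L[ℝ] H) ∧ IsHilbertSchmidt e (Q - 1) ∧ HasHSDet e Q 1}

/-- The Lie algebra `so_HS(H)`: the Hilbert-Schmidt operators `B` with `B* = -B`. -/
def soHS (e : HilbertBasis ι ℝ H) : Set (H →L[ℝ] H) :=
  {B | IsHilbertSchmidt e B ∧ ContinuousLinearMap.adjoint B = -B}

end HilbertSchmidt

/-!
The determinant enters through one estimate. For `B` skew and Hilbert-Schmidt and `S` orthogonal
with `S - 1` Hilbert-Schmidt, put `U t = exp (t B) S` and let `M t` be the compression of `U t` to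
the span of the `e_i`, `i ∈ F`. The derivative of `det (M t)` is `tr (adj (M t) M'(t))`, and `M'(t)`
is the compression of `B U t`. Inserting the resolution of the identity between `B` and `U t` splits
this trace into a sum over `k ∈ ι`: the part `k ∈ F` is `det (M t)` times the trace of the
compression of `B`, which is `0`; and each term with `k ∉ F` is at most `‖B e_k‖ ‖U t e_k - e_k‖`,
because the adjugate of a contraction is a contraction (a consequence of Hadamard's inequality). So
the derivative is bounded by the tail of a convergent series, and `exp B * S` has the same
determinant as `S` (`HasHSDet.exp_mul`). With `S = 1` this shows that `exp B` has determinant `1`;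
with `S` the reflection in a hyperplane, that `exp B * S` has determinant `-1`.

The decomposition of `Q` comes from the spectral theorem for the compact self-adjoint operator
`½ (Q - 1)* (Q - 1) = 1 - ½ (Q + Q*)`, here called the defect of `Q`. Its eigenspace for
`1 - cos θ` is `Q`-invariant, and for `0 < θ < π` the operator `Q` acts there as `cos θ + sin θ J`
with `J = (Q - Q*) / (2 sin θ)`, which is skew with `J² = -1`. For `θ = π`, where `Q = -1`, any
complex structure `J` does, and one exists as soon as the eigenspace has even dimension
(`exists_rotation_generator`). Extending `J` by `0` gives the operators `B_j`, and
`exp (θ_j B_j) = 1 + (Q - 1) P_j`, with `P_j` the projection onto the eigenspace. Thus both the sum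
`∑ θ_j B_j` and the product of the exponentials are, up to the constant `1`, orthogonal sums of
Hilbert-Schmidt operators, whose convergence is `exists_hsTendsto_sum_of_orthogonal`; the sum of the
squared norms is finite because `∑ 2 (1 - cos θ_j) n_j = |Q - 1|²` and `θ² ≤ (π² / 2) (1 - cos θ)`
(`exists_rotation_decomposition`).

Finally `ker (Q + 1)` has even dimension when `det Q = 1`: otherwise, with `v` a unit vector in it
and `R` the reflection in the hyperplane orthogonal to `v`, the space `ker (Q R + 1)` has even
dimension, so that `Q R = exp S` and `Q = exp S * R` has determinant `-1`
(`even_finrank_defectSpace_two`).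
-/

/-! ### Determinants of contractions and their derivative -/

/-- **Hadamard's inequality** for the columns of a real matrix. -/
theorem Matrix.abs_det_le_prod_norm_col {n : Type*} [Fintype n] [DecidableEq n]
    (A : Matrix n n ℝ) : |A.det| ≤ ∏ j, ‖WithLp.toLp 2 (A.col j)‖ := by
  classical
  have key : ∀ (k : ℕ) (A : Matrix (Fin k) (Fin k) ℝ),
      |A.det| ≤ ∏ j, ‖WithLp.toLp 2 (A.col j)‖ := by
    intro k A
    have : Fact (Module.finrank ℝ (EuclideanSpace ℝ (Fin k)) = k) := ⟨by simp⟩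
    let b := EuclideanSpace.basisFun (Fin k) ℝ
    have h := b.toBasis.orientation.abs_volumeForm_apply_le
      (fun j => WithLp.toLp 2 (A.col j))
    rw [Orientation.volumeForm_robust _ b rfl, Module.Basis.det_apply] at h
    convert h using 3
    ext i j
    simp [Module.Basis.toMatrix_apply, b]
  let φ := Fintype.equivFin n
  have h := key _ (A.submatrix φ.symm φ.symm)
  rw [Matrix.det_submatrix_equiv_self] at h
  refine h.trans (le_of_eq ?_)
  refine Fintype.prod_equiv φ.symm _ _ fun j => ?_
  simp only [EuclideanSpace.norm_eq]
  congr 1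
  exact Fintype.sum_equiv φ.symm _ _ fun i => rfl

/-- The adjugate of a contraction is a contraction, for the Euclidean norm. If `y` is a unit vector
and `R` is an orthogonal matrix whose column `i₀` is `y`, then `y ⬝ᵥ adj M *ᵥ x` is, up to sign,
the determinant of `M * R` with its column `i₀` replaced by `x`, and Hadamard's inequality
applies. -/
theorem Matrix.abs_dotProduct_adjugate_mulVec_le {n : Type*} [Fintype n] [DecidableEq n]
    (M : Matrix n n ℝ) (hM : ∀ v : n → ℝ, ‖WithLp.toLp 2 (M.mulVec v)‖ ≤ ‖WithLp.toLp 2 v‖)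
    (x y : n → ℝ) :
    |y ⬝ᵥ M.adjugate.mulVec x| ≤ ‖WithLp.toLp 2 y‖ * ‖WithLp.toLp 2 x‖ := by
  classical
  by_cases hy : y = 0
  · simp [hy]
  obtain ⟨i₀, -⟩ : ∃ i, y i ≠ 0 := Function.ne_iff.mp hy
  set Y : EuclideanSpace ℝ n := WithLp.toLp 2 y with hY
  have hY0 : ‖Y‖ ≠ 0 := by
    rw [norm_ne_zero_iff]
    intro h
    exact hy (by simpa [hY] using h)
  set u : EuclideanSpace ℝ n := ‖Y‖⁻¹ • Y with hu
  have hu1 : ‖u‖ = 1 := by rw [hu, norm_smul, norm_inv, norm_norm, inv_mul_cancel₀ hY0]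
  obtain ⟨b, hb⟩ : ∃ b : OrthonormalBasis n ℝ (EuclideanSpace ℝ n), b i₀ = u := by
    obtain ⟨b, hb⟩ := Orthonormal.exists_orthonormalBasis_extension_of_card_eq
      (𝕜 := ℝ) (E := EuclideanSpace ℝ n) (ι := n) (by simp) (v := fun _ => u) (s := {i₀})
      (by
        constructor
        · intro i; simpa using hu1
        · intro i j hij; exact absurd (Subsingleton.elim i j) hij)
    exact ⟨b, hb i₀ rfl⟩
  let R : Matrix n n ℝ := Matrix.of fun i j => b j i
  have hcol : ∀ j, WithLp.toLp 2 (R.col j) = b j := fun j => rfl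
  have hRR : R.transpose * R = 1 := by
    ext i j
    have := b.inner_eq_ite i j
    rw [PiLp.inner_apply] at this
    simp only [Matrix.mul_apply, Matrix.transpose_apply, Matrix.one_apply, R, Matrix.of_apply]
    rw [← this]
    refine Finset.sum_congr rfl fun k _ => ?_
    simp [mul_comm]
  have hRR' : R * R.transpose = 1 := mul_eq_one_comm.mp hRR
  have hdet : |R.det| = 1 := by
    have := congrArg Matrix.det hRR
    rw [Matrix.det_mul, Matrix.det_transpose, Matrix.det_one] at this
    rw [← sq_eq_sq₀ (abs_nonneg _) zero_le_one, sq_abs]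
    linarith [sq R.det]
  have hadj : R.adjugate = R.det • R.transpose := by
    calc R.adjugate = R.adjugate * (R * R.transpose) := by rw [hRR', Matrix.mul_one]
      _ = R.det • R.transpose := by
        rw [← Matrix.mul_assoc, Matrix.adjugate_mul, Matrix.smul_mul, Matrix.one_mul]
  have h1 : ((M * R).updateCol i₀ x).det = R.det * (u.ofLp ⬝ᵥ M.adjugate.mulVec x) := by
    rw [← Matrix.cramer_apply, Matrix.cramer_eq_adjugate_mulVec, Matrix.adjugate_mul_distrib,
      hadj, ← Matrix.mulVec_mulVec, Matrix.smul_mulVec, Pi.smul_apply, smul_eq_mul, ← hb]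
    rfl
  have h2 : |((M * R).updateCol i₀ x).det| ≤ ‖WithLp.toLp 2 x‖ := by
    refine (Matrix.abs_det_le_prod_norm_col _).trans ?_
    rw [Fintype.prod_eq_mul_prod_compl i₀]
    have hc : ((M * R).updateCol i₀ x).col i₀ = x := by ext k; simp [Matrix.col]
    rw [hc]
    refine mul_le_of_le_one_right (norm_nonneg _) (Finset.prod_le_one (fun _ _ => norm_nonneg _) ?_)
    intro j hj
    have hj : j ≠ i₀ := by simpa using hj
    have : ((M * R).updateCol i₀ x).col j = M.mulVec (R.col j) := by
      ext k
      simp [Matrix.col, hj, Matrix.mul_apply, Matrix.mulVec, dotProduct]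
    rw [this]
    exact (hM _).trans (by rw [hcol, b.norm_eq_one])
  have h3 : |u.ofLp ⬝ᵥ M.adjugate.mulVec x| ≤ ‖WithLp.toLp 2 x‖ := by
    rwa [h1, abs_mul, hdet, one_mul] at h2
  have h4 : y = ‖Y‖ • u.ofLp := by
    rw [hu, WithLp.ofLp_smul, smul_smul, mul_inv_cancel₀ hY0, one_smul]
  calc |y ⬝ᵥ M.adjugate.mulVec x| = ‖Y‖ * |u.ofLp ⬝ᵥ M.adjugate.mulVec x| := by
        conv_lhs => rw [h4]
        rw [smul_dotProduct, smul_eq_mul, abs_mul, abs_norm]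
    _ ≤ _ := by gcongr

/-- **Jacobi's formula** for the derivative of a determinant. -/
theorem Matrix.hasDerivAt_det {n : Type*} [Fintype n] [DecidableEq n]
    {M : ℝ → Matrix n n ℝ} {M' : Matrix n n ℝ} {t : ℝ}
    (h : ∀ i j, HasDerivAt (fun s => M s i j) (M' i j) t) :
    HasDerivAt (fun s => (M s).det) ((M t).adjugate * M').trace t := by
  have hd : HasDerivAt (fun s => (M s).det)
      (∑ σ : Equiv.Perm n, (Equiv.Perm.sign σ : ℤ) *
        ∑ i, (∏ j ∈ Finset.univ.erase i, M t (σ j) j) * M' (σ i) i) t := by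
    simp only [Matrix.det_apply']
    refine HasDerivAt.fun_sum fun σ _ => HasDerivAt.const_mul _ ?_
    simpa using HasDerivAt.fun_finsetProd (u := Finset.univ) (fun i _ => h (σ i) i)
  convert hd using 1
  have htr : ((M t).adjugate * M').trace = ∑ i, ((M t).updateCol i (M'.col i)).det := by
    simp only [Matrix.trace, Matrix.diag]
    refine Finset.sum_congr rfl fun i _ => ?_
    rw [← Matrix.cramer_apply, Matrix.cramer_eq_adjugate_mulVec]
    rfl
  rw [htr]
  simp only [Matrix.det_apply', Finset.mul_sum]
  rw [Finset.sum_comm]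
  refine Finset.sum_congr rfl fun σ _ => Finset.sum_congr rfl fun i _ => ?_
  congr 1
  rw [← Finset.prod_erase_mul _ _ (Finset.mem_univ i)]
  congr 1
  · refine Finset.prod_congr rfl fun j hj => ?_
    rw [Matrix.updateCol_ne (Finset.ne_of_mem_erase hj)]
  · simp [Matrix.col]

/-! ### Determinants of compressions of `exp B * S` -/

section SkewAdjoint
variable {H : Type*} [NormedAddCommGroup H] [InnerProductSpace ℝ H] [CompleteSpace H]

theorem inner_apply_self_eq_zero_of_adjoint_eq_neg {B : H →L[ℝ] H}
    (hB : ContinuousLinearMap.adjoint B = -B) (x : H) : inner ℝ x (B x) = 0 := by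
  have h := ContinuousLinearMap.adjoint_inner_left B x x
  rw [hB, neg_apply, inner_neg_left, real_inner_comm] at h
  linarith

theorem exp_mem_unitary_of_adjoint_eq_neg {B : H →L[ℝ] H}
    (hB : ContinuousLinearMap.adjoint B = -B) : NormedSpace.exp B ∈ unitary (H →L[ℝ] H) :=
  let := NormedAlgebra.restrictScalars ℚ ℝ (H →L[ℝ] H)
  NormedSpace.exp_mem_unitary_of_mem_skewAdjoint (skewAdjoint.mem_iff.mpr hB)

theorem adjoint_smul_eq_neg {B : H →L[ℝ] H}
    (hB : ContinuousLinearMap.adjoint B = -B) (t : ℝ) :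
    ContinuousLinearMap.adjoint (t • B) = -(t • B) := by
  rw [map_smulₛₗ, hB]; simp

theorem adjoint_exp_of_adjoint_eq_neg {B : H →L[ℝ] H}
    (hB : ContinuousLinearMap.adjoint B = -B) :
    ContinuousLinearMap.adjoint (NormedSpace.exp B) = NormedSpace.exp (-B) := by
  let := NormedAlgebra.restrictScalars ℚ ℝ (H →L[ℝ] H)
  have := NormedSpace.star_exp B
  rw [ContinuousLinearMap.star_eq_adjoint, ContinuousLinearMap.star_eq_adjoint, hB] at this
  exact this

theorem norm_apply_of_mem_unitary {U : H →L[ℝ] H} (hU : U ∈ unitary (H →L[ℝ] H)) (x : H) :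
    ‖U x‖ = ‖x‖ :=
  (ContinuousLinearMap.norm_map_iff_adjoint_comp_self U).mpr hU.1 x

/-- The mean value inequality for `t ↦ exp (t B) x`, whose derivative `exp (t B) (B x)` has norm
`‖B x‖`. -/
theorem norm_exp_apply_sub_le {B : H →L[ℝ] H}
    (hB : ContinuousLinearMap.adjoint B = -B) (x : H) :
    ‖NormedSpace.exp B x - x‖ ≤ ‖B x‖ := by
  have hd : ∀ t : ℝ, HasDerivAt (fun s : ℝ => NormedSpace.exp (s • B) x)
      (NormedSpace.exp (t • B) (B x)) t := fun t =>
    (ContinuousLinearMap.apply ℝ H x).hasFDerivAt.comp_hasDerivAt t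
      (hasDerivAt_exp_smul_const B t)
  have := norm_image_sub_le_of_norm_deriv_le_segment_01'
    (fun t _ => (hd t).hasDerivWithinAt) (C := ‖B x‖)
    (fun t _ => (norm_apply_of_mem_unitary
      (exp_mem_unitary_of_adjoint_eq_neg (adjoint_smul_eq_neg hB t)) _).le)
  simpa using this

theorem norm_adjoint_apply_sub_of_mem_unitary {U : H →L[ℝ] H}
    (hU : U ∈ unitary (H →L[ℝ] H)) (x : H) :
    ‖ContinuousLinearMap.adjoint U x - x‖ = ‖U x - x‖ := by
  rw [← norm_apply_of_mem_unitary hU, map_sub, norm_sub_rev]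
  congr 2
  exact DFunLike.congr_fun hU.2 x

end SkewAdjoint

section Reflection
variable {ι H : Type*} [NormedAddCommGroup H] [InnerProductSpace ℝ H]

/-- The operator `x ↦ x - 2 ⟨v, x⟩ v`. For a unit vector `v` it is the reflection in
the hyperplane orthogonal to `v`; it is defined for every `v` to avoid carrying `‖v‖ = 1` around. -/
noncomputable def hyperplaneReflection (v : H) : H →L[ℝ] H :=
  1 - (2 : ℝ) • InnerProductSpace.rankOne ℝ v v

theorem hyperplaneReflection_apply (v x : H) :
    hyperplaneReflection v x = x - (2 * inner ℝ v x : ℝ) • v := by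
  simp [hyperplaneReflection, smul_smul]

theorem hyperplaneReflection_mul_self {v : H} (hv : ‖v‖ = 1) :
    hyperplaneReflection v * hyperplaneReflection v = 1 := by
  ext x
  change hyperplaneReflection v (hyperplaneReflection v x) = x
  simp only [hyperplaneReflection_apply, inner_sub_right, inner_smul_right,
    real_inner_self_eq_norm_sq, hv]
  module

theorem hasHSDet_one [LinearOrder ι] [LocallyFiniteOrderBot ι] (e : HilbertBasis ι ℝ H) :
    HasHSDet e (1 : H →L[ℝ] H) 1 := by
  have : ∀ n : ι, (Matrix.of fun i j : ↥(Finset.Iic n) =>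
      (inner ℝ (e (i : ι)) ((1 : H →L[ℝ] H) (e (j : ι))) : ℝ)) = 1 := by
    intro n
    ext i j
    have h := orthonormal_iff_ite.mp e.orthonormal (i : ι) (j : ι)
    simp only [Subtype.coe_inj] at h
    exact h
  simp only [HasHSDet, this, Matrix.det_one]
  exact tendsto_const_nhds

theorem isHilbertSchmidt_hyperplaneReflection_sub_one (e : HilbertBasis ι ℝ H) (v : H) :
    IsHilbertSchmidt e (hyperplaneReflection v - 1) := by
  have h := (e.summable_inner_mul_inner v v).mul_left (4 * ‖v‖ ^ 2)
  refine h.congr fun i => ?_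
  have : (hyperplaneReflection v - 1) (e i) = -((2 * inner ℝ v (e i) : ℝ) • v) := by
    change hyperplaneReflection v (e i) - e i = _
    rw [hyperplaneReflection_apply]; abel
  rw [this, norm_neg, norm_smul, mul_pow, Real.norm_eq_abs, sq_abs, real_inner_comm v (e i)]
  ring

theorem hasHSDet_hyperplaneReflection [LinearOrder ι] [LocallyFiniteOrderBot ι]
    (e : HilbertBasis ι ℝ H) {v : H} (hv : ‖v‖ = 1) :
    HasHSDet e (hyperplaneReflection v) (-1) := by
  have hdet : ∀ n : ι, (Matrix.of fun i j : ↥(Finset.Iic n) =>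
      (inner ℝ (e (i : ι)) (hyperplaneReflection v (e (j : ι))) : ℝ)).det =
      1 + ∑ i ∈ Finset.Iic n, -2 * (inner ℝ v (e i) * inner ℝ (e i) v) := by
    intro n
    rw [← Finset.sum_coe_sort]
    have := Matrix.det_one_add_replicateCol_mul_replicateRow (ι := Unit)
      (fun i : ↥(Finset.Iic n) => -2 * (inner ℝ (e (i : ι)) v : ℝ))
      (fun i : ↥(Finset.Iic n) => (inner ℝ v (e (i : ι)) : ℝ))
    convert this using 2
    · ext i j
      have h := orthonormal_iff_ite.mp e.orthonormal (i : ι) (j : ι)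
      simp only [Matrix.of_apply, hyperplaneReflection_apply, inner_sub_right, inner_smul_right, h,
        Matrix.add_apply, Matrix.one_apply, Subtype.coe_inj, Matrix.mul_apply,
        Matrix.replicateCol_apply, Matrix.replicateRow_apply, Finset.univ_unique,
        Finset.sum_singleton]
      ring
    · exact Finset.sum_congr rfl fun i _ => by ring
  simp only [HasHSDet, hdet]
  have h := ((e.hasSum_inner_mul_inner v v).mul_left (-2)).comp
    (tendsto_finset_Iic_atTop_atTop (α := ι))
  have h' := h.const_add 1
  rw [real_inner_self_eq_norm_sq, hv] at h'
  rwa [show (1 : ℝ) + -2 * 1 ^ 2 = -1 by norm_num] at h'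

theorem hyperplaneReflection_mem_unitary [CompleteSpace H] {v : H} (hv : ‖v‖ = 1) :
    hyperplaneReflection v ∈ unitary (H →L[ℝ] H) := by
  have h : star (hyperplaneReflection v) = hyperplaneReflection v := by
    simp [hyperplaneReflection, ContinuousLinearMap.star_eq_adjoint]
  rw [Unitary.mem_iff, h]
  exact ⟨hyperplaneReflection_mul_self hv, hyperplaneReflection_mul_self hv⟩

end Reflection

section Compression
variable {ι H : Type*} [NormedAddCommGroup H] [InnerProductSpace ℝ H]

/-- The matrix of the compression of `A` to the span of the `e i`, `i ∈ F`. -/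
noncomputable def compression (e : HilbertBasis ι ℝ H) (F : Finset ι) (A : H →L[ℝ] H) :
    Matrix F F ℝ :=
  Matrix.of fun i j => inner ℝ (e (i : ι)) (A (e (j : ι)))

theorem norm_toLp_inner_le (e : HilbertBasis ι ℝ H) (F : Finset ι) (x : H) :
    ‖WithLp.toLp 2 (fun i : F => (inner ℝ (e (i : ι)) x : ℝ))‖ ≤ ‖x‖ := by
  rw [← sq_le_sq₀ (norm_nonneg _) (norm_nonneg _), EuclideanSpace.norm_sq_eq]
  have := e.orthonormal.sum_inner_products_le (s := F) x
  rwa [← Finset.sum_coe_sort] at this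

theorem norm_compression_mulVec_le [DecidableEq ι] (e : HilbertBasis ι ℝ H) (F : Finset ι)
    {A : H →L[ℝ] H}
    (hA : ∀ x, ‖A x‖ ≤ ‖x‖) (v : F → ℝ) :
    ‖WithLp.toLp 2 ((compression e F A).mulVec v)‖ ≤ ‖WithLp.toLp 2 v‖ := by
  have h1 : (compression e F A).mulVec v =
      fun i : F => (inner ℝ (e (i : ι)) (A (∑ j : F, v j • e (j : ι))) : ℝ) := by
    ext i
    simp [compression, Matrix.mulVec, dotProduct, inner_sum, inner_smul_right, mul_comm]
  rw [h1]
  refine (norm_toLp_inner_le e F _).trans ((hA _).trans (le_of_eq ?_))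
  have ho : Orthonormal ℝ fun j : F => e (j : ι) :=
    e.orthonormal.comp _ Subtype.val_injective
  rw [← sq_eq_sq₀ (norm_nonneg _) (norm_nonneg _), EuclideanSpace.norm_sq_eq,
    ← real_inner_self_eq_norm_sq, ho.inner_sum]
  simp [sq]

variable [CompleteSpace H]

/-- The derivative of the determinant of the compression of `U` in the direction `B * U`, for `B`
skew and `U` orthogonal, is controlled by the basis vectors outside `F`. -/
theorem abs_trace_adjugate_mul_compression_le [DecidableEq ι] (e : HilbertBasis ι ℝ H)
    (F : Finset ι) {B U : H →L[ℝ] H} (hB : ContinuousLinearMap.adjoint B = -B)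
    (hU : U ∈ unitary (H →L[ℝ] H)) {g : ι → ℝ} (hg : Summable g)
    (hBg : ∀ k, ‖B (e k)‖ * ‖U (e k) - e k‖ ≤ g k) :
    |((compression e F U).adjugate * compression e F (B * U)).trace| ≤
      ∑' k : {k // k ∉ F}, g k := by
  set M := compression e F U with hM
  set x : ι → F → ℝ := fun k i => inner ℝ (e (i : ι)) (B (e k)) with hx
  set y : ι → F → ℝ := fun k j => inner ℝ (e k) (U (e (j : ι))) with hy
  set G : ι → ℝ := fun k => y k ⬝ᵥ M.adjugate.mulVec (x k) with hG
  have hexp : ∀ k, G k = ∑ j, ∑ i, M.adjugate j i * (x k i * y k j) := by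
    intro k
    simp only [hG, dotProduct, Matrix.mulVec, Finset.mul_sum]
    exact Finset.sum_congr rfl fun j _ => Finset.sum_congr rfl fun i _ => by ring
  -- insert `∑ k, ⟨·, e k⟩ e k` between `B` and `U`
  have hsum : HasSum G (M.adjugate * compression e F (B * U)).trace := by
    have : (M.adjugate * compression e F (B * U)).trace =
        ∑ j, ∑ i, M.adjugate j i * inner ℝ (e (i : ι)) (B (U (e (j : ι)))) := by
      simp [Matrix.trace, Matrix.mul_apply, compression]
    rw [this]
    simp only [funext hexp]
    refine hasSum_sum fun j _ => hasSum_sum fun i _ => HasSum.mul_left _ ?_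
    have := e.hasSum_inner_mul_inner (ContinuousLinearMap.adjoint B (e i)) (U (e (j : ι)))
    simpa only [ContinuousLinearMap.adjoint_inner_left] using this
  -- the part `k ∈ F` is `tr (adj M * C * M) = det M * tr C`, with `C` the compression of `B`
  have hF : ∑ k ∈ F, G k = 0 := by
    have h1 : ∑ k ∈ F, G k = (M.adjugate * (compression e F B * M)).trace := by
      rw [← Finset.sum_coe_sort]
      simp only [hexp, Matrix.trace, Matrix.diag, Matrix.mul_apply, Finset.mul_sum]
      rw [Finset.sum_comm]
      refine Finset.sum_congr rfl fun j _ => ?_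
      rw [Finset.sum_comm]
      rfl
    have h2 : (compression e F B).trace = 0 :=
      Finset.sum_eq_zero fun i _ => inner_apply_self_eq_zero_of_adjoint_eq_neg hB _
    rw [h1, ← Matrix.mul_assoc, Matrix.trace_mul_comm, ← Matrix.mul_assoc, Matrix.mul_adjugate,
      Matrix.smul_mul, Matrix.one_mul, Matrix.trace_smul, h2, smul_zero]
  have htail : (M.adjugate * compression e F (B * U)).trace = ∑' k : {k // k ∉ F}, G k := by
    rw [← hsum.tsum_eq, ← hsum.summable.sum_add_tsum_subtype_compl F, hF, zero_add]
  have hbound : ∀ k : {k // k ∉ F}, ‖G k‖ ≤ g k := by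
    rintro ⟨k, hk⟩
    refine le_trans ?_ (hBg k)
    have h1 := M.abs_dotProduct_adjugate_mulVec_le
      (norm_compression_mulVec_le e F fun x => (norm_apply_of_mem_unitary hU x).le) (x k) (y k)
    have h2 : ‖WithLp.toLp 2 (x k)‖ ≤ ‖B (e k)‖ := norm_toLp_inner_le e F _
    have h3 : ‖WithLp.toLp 2 (y k)‖ ≤ ‖U (e k) - e k‖ := by
      rw [← norm_adjoint_apply_sub_of_mem_unitary hU]
      convert norm_toLp_inner_le e F (ContinuousLinearMap.adjoint U (e k) - e k) using 4 with j
      -- `e k` is orthogonal to `e j`, so `U` may be replaced by `U - 1`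
      have hjk : (j : ι) ≠ k := fun h => hk (h ▸ j.2)
      rw [inner_sub_right, e.orthonormal.inner_eq_zero hjk, sub_zero,
        ContinuousLinearMap.adjoint_inner_right, real_inner_comm]
    calc ‖G k‖ ≤ _ := h1
      _ ≤ ‖U (e k) - e k‖ * ‖B (e k)‖ := by gcongr
      _ = _ := mul_comm _ _
  rw [htail]
  exact tsum_of_norm_bounded (hg.subtype _).hasSum hbound

/-- Integrating the previous estimate along `t ↦ exp (t B) * S`, `0 ≤ t ≤ 1`. -/
theorem abs_det_compression_exp_mul_sub_le [DecidableEq ι] (e : HilbertBasis ι ℝ H)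
    (F : Finset ι) {B S : H →L[ℝ] H} (hB : ContinuousLinearMap.adjoint B = -B)
    (hS : S ∈ unitary (H →L[ℝ] H)) {g : ι → ℝ} (hg : Summable g)
    (hBg : ∀ k, ‖B (e k)‖ * (‖B (e k)‖ + ‖S (e k) - e k‖) ≤ g k) :
    |(compression e F (NormedSpace.exp B * S)).det - (compression e F S).det| ≤
      ∑' k : {k // k ∉ F}, g k := by
  set U : ℝ → H →L[ℝ] H := fun t => NormedSpace.exp (t • B) * S with hUdef
  have hU : ∀ t, U t ∈ unitary (H →L[ℝ] H) := fun t =>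
    mul_mem (exp_mem_unitary_of_adjoint_eq_neg (adjoint_smul_eq_neg hB t)) hS
  have hd : ∀ t, HasDerivAt (fun s => (compression e F (U s)).det)
      ((compression e F (U t)).adjugate * compression e F (B * U t)).trace t := by
    intro t
    refine Matrix.hasDerivAt_det fun i j => ?_
    have h1 : HasDerivAt (fun s : ℝ => NormedSpace.exp (s • B) (S (e (j : ι))))
        (B (NormedSpace.exp (t • B) (S (e (j : ι))))) t :=
      (ContinuousLinearMap.apply ℝ H (S (e (j : ι)))).hasFDerivAt.comp_hasDerivAt t
        (hasDerivAt_exp_smul_const' B t)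
    exact (innerSL ℝ (e (i : ι))).hasFDerivAt.comp_hasDerivAt t h1
  have hb : ∀ t ∈ Set.Ico (0 : ℝ) 1,
      ‖((compression e F (U t)).adjugate * compression e F (B * U t)).trace‖ ≤
        ∑' k : {k // k ∉ F}, g k := by
    intro t ht
    refine abs_trace_adjugate_mul_compression_le e F hB (hU t) hg fun k => ?_
    refine le_trans ?_ (hBg k)
    gcongr
    rw [← norm_adjoint_apply_sub_of_mem_unitary (hU t)]
    -- `U* - 1 = S* (exp (-t B) - 1) + (S* - 1)`
    have hUs : ContinuousLinearMap.adjoint (U t) (e k) - e k =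
        ContinuousLinearMap.adjoint S (NormedSpace.exp (-(t • B)) (e k) - e k) +
          (ContinuousLinearMap.adjoint S (e k) - e k) := by
      rw [← adjoint_exp_of_adjoint_eq_neg (adjoint_smul_eq_neg hB t), map_sub,
        sub_add_sub_cancel, hUdef]
      simp only [← ContinuousLinearMap.star_eq_adjoint, star_mul]
      rfl
    rw [hUs]
    refine (norm_add_le _ _).trans (add_le_add ?_ ?_)
    · have hS' : ContinuousLinearMap.adjoint S ∈ unitary (H →L[ℝ] H) :=
        Unitary.star_mem hS
      rw [norm_apply_of_mem_unitary hS', ← neg_smul]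
      refine (norm_exp_apply_sub_le (adjoint_smul_eq_neg hB (-t)) _).trans ?_
      rw [smul_apply, norm_smul, norm_neg, Real.norm_of_nonneg ht.1]
      exact mul_le_of_le_one_left (norm_nonneg _) ht.2.le
    · rw [norm_adjoint_apply_sub_of_mem_unitary hS]
  have := norm_image_sub_le_of_norm_deriv_le_segment_01'
    (fun t _ => (hd t).hasDerivWithinAt) hb
  simpa [hUdef] using this

/-- Multiplication by `exp B`, with `B` skew and Hilbert-Schmidt, does not change the
determinant. -/
theorem HasHSDet.exp_mul [Nonempty ι] [LinearOrder ι] [LocallyFiniteOrderBot ι]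
    {e : HilbertBasis ι ℝ H} {B S : H →L[ℝ] H} {d : ℝ} (hd : HasHSDet e S d) (hB : B ∈ soHS e)
    (hS : S ∈ unitary (H →L[ℝ] H)) (hS1 : IsHilbertSchmidt e (S - 1)) :
    HasHSDet e (NormedSpace.exp B * S) d := by
  have h1 : Summable fun k => ‖B (e k)‖ ^ 2 := hB.1
  have h2 : Summable fun k => ‖S (e k) - e k‖ ^ 2 := hS1
  -- `b (b + s) ≤ 2 b² + s²`
  have hlim := (tendsto_tsum_compl_atTop_zero
    fun k => 2 * ‖B (e k)‖ ^ 2 + ‖S (e k) - e k‖ ^ 2).comp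
      (tendsto_finset_Iic_atTop_atTop (α := ι))
  have hdiff : Tendsto (fun n : ι =>
      (compression e (Finset.Iic n) (NormedSpace.exp B * S)).det -
        (compression e (Finset.Iic n) S).det) atTop (𝓝 0) :=
    squeeze_zero_norm (fun n => abs_det_compression_exp_mul_sub_le e (Finset.Iic n) hB.2 hS
      ((h1.mul_left 2).add h2) fun k => by nlinarith [sq_nonneg (‖B (e k)‖ - ‖S (e k) - e k‖)])
      hlim
  have := hdiff.add (show Tendsto (fun n : ι => (compression e (Finset.Iic n) S).det) atTop (𝓝 d)
    from hd)
  simpa [HasHSDet, compression] using this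

theorem exp_mem_SOHS [Nonempty ι] [LinearOrder ι] [LocallyFiniteOrderBot ι]
    {e : HilbertBasis ι ℝ H} {B : H →L[ℝ] H} (hB : B ∈ soHS e) :
    NormedSpace.exp B ∈ SOHS e := by
  refine ⟨exp_mem_unitary_of_adjoint_eq_neg hB.2, ?_, ?_⟩
  · refine Summable.of_nonneg_of_le (fun i => by positivity) (fun i => ?_) hB.1
    have := norm_exp_apply_sub_le hB.2 (e i)
    exact pow_le_pow_left₀ (norm_nonneg _) this 2
  · simpa using (hasHSDet_one e).exp_mul hB (one_mem _)
      (by simp [IsHilbertSchmidt])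

end Compression

/-! ### Hilbert-Schmidt operators and orthogonal sums -/

section Summation

/-- Tonelli for double series of nonnegative reals: if the row sums have sum `C`, so do the column
sums. -/
theorem HasSum.swap_of_nonneg {α β : Type*} {f : α → β → ℝ} {c : α → ℝ} {d : β → ℝ} {C : ℝ}
    (hf : ∀ a b, 0 ≤ f a b) (hc : ∀ a, HasSum (f a) (c a)) (hC : HasSum c C)
    (hd : ∀ b, HasSum (fun a => f a b) (d b)) : HasSum d C := by
  have hs : Summable (Function.uncurry f) := by
    rw [summable_prod_of_nonneg (f := Function.uncurry f) fun p => hf p.1 p.2]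
    refine ⟨fun a => (hc a).summable, ?_⟩
    simpa only [Function.uncurry_apply_pair, (hc _).tsum_eq] using hC.summable
  have h1 : HasSum (Function.uncurry f) C := by
    have h := hs.hasSum.prod_fiberwise hc
    rw [← h.unique hC]
    exact hs.hasSum
  exact ((Equiv.prodComm β α).hasSum_iff.mpr h1).prod_fiberwise hd

/-- **Parseval's identity** for a convergent series of pairwise orthogonal vectors. -/
theorem HasSum.norm_sq_of_pairwise_orthogonal {α H : Type*} [NormedAddCommGroup H]
    [InnerProductSpace ℝ H] {f : α → H} {x : H} (hf : HasSum f x)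
    (ho : Pairwise fun j k => inner ℝ (f j) (f k) = (0 : ℝ)) :
    HasSum (fun j => ‖f j‖ ^ 2) (‖x‖ ^ 2) := by
  classical
  refine (hf.norm.pow 2).congr fun s => ?_
  rw [← real_inner_self_eq_norm_sq, sum_inner]
  refine Finset.sum_congr rfl fun j hj => ?_
  rw [inner_sum, Finset.sum_eq_single_of_mem j hj fun k _ hk => ho hk.symm,
    real_inner_self_eq_norm_sq]

end Summation

section HilbertSchmidtOperators
variable {ι H : Type*} [NormedAddCommGroup H] [InnerProductSpace ℝ H]

theorem hsNorm_sq (e : HilbertBasis ι ℝ H) (A : H →L[ℝ] H) :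
    hsNorm e A ^ 2 = ∑' i, ‖A (e i)‖ ^ 2 :=
  Real.sq_sqrt (tsum_nonneg fun _ => by positivity)

theorem IsHilbertSchmidt.hasSum {e : HilbertBasis ι ℝ H} {A : H →L[ℝ] H}
    (hA : IsHilbertSchmidt e A) : HasSum (fun i => ‖A (e i)‖ ^ 2) (hsNorm e A ^ 2) := by
  rw [hsNorm_sq]
  exact Summable.hasSum hA

theorem IsHilbertSchmidt.add {e : HilbertBasis ι ℝ H} {A B : H →L[ℝ] H}
    (hA : IsHilbertSchmidt e A) (hB : IsHilbertSchmidt e B) : IsHilbertSchmidt e (A + B) := by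
  refine Summable.of_nonneg_of_le (fun i => by positivity) (fun i => ?_)
    ((Summable.add hA hB).mul_left 2)
  calc ‖(A + B) (e i)‖ ^ 2 ≤ (‖A (e i)‖ + ‖B (e i)‖) ^ 2 := by
        gcongr; exact norm_add_le _ _
    _ ≤ 2 * (‖A (e i)‖ ^ 2 + ‖B (e i)‖ ^ 2) := add_sq_le

theorem IsHilbertSchmidt.mul_left {e : HilbertBasis ι ℝ H} {A : H →L[ℝ] H}
    (hA : IsHilbertSchmidt e A) (T : H →L[ℝ] H) : IsHilbertSchmidt e (T * A) := by
  refine Summable.of_nonneg_of_le (fun i => by positivity) (fun i => ?_)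
    (Summable.mul_left (‖T‖ ^ 2) hA)
  rw [← mul_pow]
  exact pow_le_pow_left₀ (norm_nonneg _) (T.le_opNorm _) 2

theorem IsHilbertSchmidt.norm_apply_le {e : HilbertBasis ι ℝ H} {A : H →L[ℝ] H}
    (hA : IsHilbertSchmidt e A) (x : H) : ‖A x‖ ≤ hsNorm e A * ‖x‖ := by
  have h1 : HasSum (fun i => (inner ℝ (e i) x : ℝ) • A (e i)) (A x) := by
    have := (e.hasSum_repr x).mapL A
    simpa [e.repr_apply_apply] using this
  have hx : HasSum (fun i => |(inner ℝ (e i) x : ℝ)| ^ 2) (‖x‖ ^ 2) := by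
    have := e.hasSum_inner_mul_inner x x
    rw [real_inner_self_eq_norm_sq] at this
    refine this.congr_fun fun i => ?_
    rw [real_inner_comm x (e i), sq_abs, sq]
  refine le_of_tendsto h1.norm (Eventually.of_forall fun s => ?_)
  calc ‖∑ i ∈ s, (inner ℝ (e i) x : ℝ) • A (e i)‖
      ≤ ∑ i ∈ s, ‖A (e i)‖ * |(inner ℝ (e i) x : ℝ)| := by
        refine (norm_sum_le _ _).trans (le_of_eq (Finset.sum_congr rfl fun i _ => ?_))
        rw [norm_smul, Real.norm_eq_abs, mul_comm]
    _ ≤ √(∑ i ∈ s, ‖A (e i)‖ ^ 2) * √(∑ i ∈ s, |(inner ℝ (e i) x : ℝ)| ^ 2) :=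
        Real.sum_mul_le_sqrt_mul_sqrt _ _ _
    _ ≤ √(hsNorm e A ^ 2) * √(‖x‖ ^ 2) := by
        gcongr
        · exact sum_le_hasSum _ (fun i _ => by positivity) hA.hasSum
        · exact sum_le_hasSum _ (fun i _ => by positivity) hx
    _ = hsNorm e A * ‖x‖ := by
        rw [Real.sqrt_sq (norm_nonneg x),
          Real.sqrt_sq (show 0 ≤ hsNorm e A from Real.sqrt_nonneg _)]

theorem IsHilbertSchmidt.norm_le {e : HilbertBasis ι ℝ H} {A : H →L[ℝ] H}
    (hA : IsHilbertSchmidt e A) : ‖A‖ ≤ hsNorm e A :=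
  A.opNorm_le_bound (Real.sqrt_nonneg _) hA.norm_apply_le

theorem HSTendsto.tendsto {α : Type*} {e : HilbertBasis ι ℝ H} {F : α → H →L[ℝ] H}
    {l : Filter α} {A : H →L[ℝ] H} (h : HSTendsto e F l A) : Tendsto F l (𝓝 A) :=
  tendsto_iff_norm_sub_tendsto_zero.mpr
    (squeeze_zero (fun _ => norm_nonneg _) (fun x => (h.1 x).norm_le) h.2)

/-- A Hilbert-Schmidt operator is the limit of its compositions with the projections onto the spans
of finitely many basis vectors. -/
theorem IsHilbertSchmidt.isCompactOperator [CompleteSpace H] {e : HilbertBasis ι ℝ H}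
    {A : H →L[ℝ] H} (hA : IsHilbertSchmidt e A) : IsCompactOperator A := by
  classical
  let F : Finset ι → H →L[ℝ] H := fun s => ∑ i ∈ s, InnerProductSpace.rankOne ℝ (A (e i)) (e i)
  have hF : ∀ s i, (F s - A) (e i) = if i ∈ s then 0 else -A (e i) := by
    intro s i
    have h := fun j => orthonormal_iff_ite.mp e.orthonormal j i
    simp only [F, sub_apply, sum_apply, InnerProductSpace.rankOne_apply, h, ite_smul, one_smul,
      zero_smul, Finset.sum_ite_eq']
    split_ifs <;> simp
  have hsq : ∀ s i, ‖(F s - A) (e i)‖ ^ 2 =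
      ((sᶜ : Set ι)).indicator (fun i => ‖A (e i)‖ ^ 2) i := by
    intro s i
    rw [hF]
    by_cases hi : i ∈ s <;> simp [hi]
  have hlim : HSTendsto e F atTop A := by
    refine ⟨fun s => ?_, ?_⟩
    · simp only [IsHilbertSchmidt, hsq]
      exact Summable.indicator hA _
    · have h := (tendsto_tsum_compl_atTop_zero fun i => ‖A (e i)‖ ^ 2).sqrt
      rw [Real.sqrt_zero] at h
      refine h.congr fun s => ?_
      simp only [hsNorm, hsq]
      rw [← tsum_subtype]
      rfl
  refine isCompactOperator_of_tendsto hlim.tendsto (Eventually.of_forall fun s => ?_)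
  refine Finset.sum_induction _ (fun T : H →L[ℝ] H => IsCompactOperator T)
    (fun S T hS hT => hS.add hT) isCompactOperator_zero fun i _ => ?_
  have hr : IsCompactOperator (innerSL ℝ (e i)) :=
    isCompactOperator_of_locallyCompactSpace_dom _
  exact hr.clm_comp (ContinuousLinearMap.toSpanSingleton ℝ (A (e i)))

/-- A family of Hilbert-Schmidt operators with mutually orthogonal values, whose squared
Hilbert-Schmidt norms `c j` are summable, converges unconditionally in the Hilbert-Schmidt norm, and
the squared norm of the sum is the sum of the `c j`. -/
theorem exists_hsTendsto_sum_of_orthogonal [CompleteSpace H] {α : Type*}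
    (e : HilbertBasis ι ℝ H) (T : α → H →L[ℝ] H) {c : α → ℝ}
    (ho : ∀ x, Pairwise fun j k => inner ℝ (T j x) (T k x) = (0 : ℝ))
    (hT : ∀ j, HasSum (fun i => ‖T j (e i)‖ ^ 2) (c j)) (hc : Summable c) :
    ∃ S : H →L[ℝ] H, HSTendsto e (fun s => ∑ j ∈ s, T j) atTop S ∧ IsHilbertSchmidt e S ∧
      HasSum c (hsNorm e S ^ 2) ∧ ∀ x, HasSum (fun j => T j x) (S x) := by
  classical
  have hfin : ∀ s : Finset α, HasSum (fun i => ‖(∑ j ∈ s, T j) (e i)‖ ^ 2) (∑ j ∈ s, c j) := by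
    intro s
    refine HasSum.congr_fun (hasSum_sum fun j (_ : j ∈ s) => hT j) fun i => ?_
    rw [sum_apply, ← real_inner_self_eq_norm_sq, sum_inner]
    refine Finset.sum_congr rfl fun j hj => ?_
    rw [inner_sum, Finset.sum_eq_single_of_mem j hj fun k _ hk => ho _ hk.symm,
      real_inner_self_eq_norm_sq]
  have hnorm : ∀ s : Finset α, ‖∑ j ∈ s, T j‖ ≤ √(∑ j ∈ s, c j) := by
    intro s
    have h : IsHilbertSchmidt e (∑ j ∈ s, T j) := (hfin s).summable
    refine h.norm_le.trans (le_of_eq ?_)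
    rw [hsNorm, (hfin s).tsum_eq]
  have hsum : Summable T := by
    rw [summable_iff_vanishing_norm]
    intro ε hε
    obtain ⟨s, hs⟩ := summable_iff_vanishing_norm.mp hc (ε ^ 2) (by positivity)
    refine ⟨s, fun t ht => (hnorm t).trans_lt ?_⟩
    rw [Real.sqrt_lt' hε]
    exact (le_abs_self _).trans_lt (hs t ht)
  obtain ⟨S, hS⟩ := hsum
  have hSx : ∀ x, HasSum (fun j => T j x) (S x) := fun x =>
    hS.mapL (ContinuousLinearMap.apply ℝ H x)
  have hdiff : ∀ s : Finset α, HasSum (fun i => ‖(∑ j ∈ s, T j - S) (e i)‖ ^ 2)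
      (∑' j : {j // j ∉ s}, c j) := by
    intro s
    refine HasSum.swap_of_nonneg (f := fun (j : {j // j ∉ s}) i => ‖T j (e i)‖ ^ 2)
      (fun _ _ => by positivity) (fun j => hT j) (hc.subtype _).hasSum fun i => ?_
    have h1 : HasSum (fun j : {j // j ∉ s} => T j (e i)) (-((∑ j ∈ s, T j - S) (e i))) := by
      have h := (Finset.hasSum_compl_iff s (f := fun j => T j (e i))
        (a := S (e i) - ∑ j ∈ s, T j (e i))).mpr (by simpa using hSx (e i))
      simpa using h
    have h2 := h1.norm_sq_of_pairwise_orthogonal fun j k hjk =>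
      ho (e i) (Subtype.coe_injective.ne hjk)
    rwa [norm_neg] at h2
  refine ⟨S, ⟨fun s => (hdiff s).summable, ?_⟩, ?_, ?_, hSx⟩
  · have h := (tendsto_tsum_compl_atTop_zero c).sqrt
    rw [Real.sqrt_zero] at h
    exact h.congr fun s => by rw [hsNorm, (hdiff s).tsum_eq]
  · have h := hdiff ∅
    simpa [IsHilbertSchmidt] using h.summable
  · refine HasSum.swap_of_nonneg (f := fun i j => ‖T j (e i)‖ ^ 2) (fun _ _ => by positivity)
      (fun i => (hSx (e i)).norm_sq_of_pairwise_orthogonal (ho (e i))) ?_ hT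
    apply IsHilbertSchmidt.hasSum
    have h := hdiff ∅
    simpa [IsHilbertSchmidt] using h.summable

/-- The squared Hilbert-Schmidt norm of an orthogonal projection of finite rank is its rank. -/
theorem hasSum_norm_sq_starProjection (e : HilbertBasis ι ℝ H) (E : Submodule ℝ H)
    [FiniteDimensional ℝ E] :
    HasSum (fun i => ‖E.starProjection (e i)‖ ^ 2) (Module.finrank ℝ E : ℝ) := by
  let b := stdOrthonormalBasis ℝ E
  have h1 : ∀ k, HasSum (fun i => (inner ℝ (b k : H) (e i) : ℝ) ^ 2) 1 := by
    intro k
    have h := e.hasSum_inner_mul_inner (b k : H) (b k : H)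
    rw [real_inner_self_eq_norm_sq, Submodule.norm_coe, b.norm_eq_one, one_pow] at h
    refine h.congr_fun fun i => ?_
    rw [real_inner_comm (b k : H) (e i), sq]
  have h2 := hasSum_sum fun k (_ : k ∈ Finset.univ) => h1 k
  simp only [Finset.sum_const, Finset.card_univ, Fintype.card_fin, nsmul_eq_mul, mul_one] at h2
  refine h2.congr_fun fun i => ?_
  have h3 : ‖E.starProjection (e i)‖ = ‖E.orthogonalProjectionOnto (e i)‖ := rfl
  rw [h3, ← b.sum_sq_norm_inner_right]
  refine Finset.sum_congr rfl fun k _ => ?_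
  simp

end HilbertSchmidtOperators

/-! ### Plane rotations and eigenspaces of the defect operator -/

/-- **Rodrigues' rotation formula**, in a Banach algebra: `exp (-θ b)` times the right hand side is
constant in `θ`. -/
theorem exp_smul_of_pow_three_eq_neg {A : Type*} [NormedRing A] [NormedAlgebra ℝ A]
    [CompleteSpace A] {b : A} (hb : b ^ 3 = -b) (θ : ℝ) :
    NormedSpace.exp (θ • b) = 1 + Real.sin θ • b + (1 - Real.cos θ) • b ^ 2 := by
  let := NormedAlgebra.restrictScalars ℚ ℝ A
  have hd : ∀ t : ℝ, HasDerivAt (fun s : ℝ => NormedSpace.exp (s • -b) *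
      (1 + Real.sin s • b + (1 - Real.cos s) • b ^ 2)) 0 t := by
    intro t
    have h1 := hasDerivAt_exp_smul_const (-b) t
    have h2 : HasDerivAt (fun s : ℝ => 1 + Real.sin s • b + (1 - Real.cos s) • b ^ 2)
        (Real.cos t • b + Real.sin t • b ^ 2) t := by
      have hs := ((Real.hasDerivAt_sin t).smul_const b).const_add 1
      have hc := ((Real.hasDerivAt_cos t).const_sub 1).smul_const (b ^ 2)
      simpa using! hs.add hc
    have h3 := h1.mul h2
    have h4 : -b * (1 + Real.sin t • b + (1 - Real.cos t) • b ^ 2) +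
        (Real.cos t • b + Real.sin t • b ^ 2) = 0 := by
      have hb' : b * b ^ 2 = -b := by rw [← pow_succ', hb]
      simp only [mul_add, mul_one, mul_smul_comm, neg_mul, hb', ← sq]
      module
    rw [mul_assoc, ← mul_add, h4, mul_zero] at h3
    exact h3
  have hconst := is_const_of_deriv_eq_zero (fun t => (hd t).differentiableAt)
    (fun t => (hd t).deriv) θ 0
  simp only [zero_smul, NormedSpace.exp_zero, Real.sin_zero, Real.cos_zero, sub_self, add_zero,
    mul_one] at hconst
  have hinv : NormedSpace.exp (θ • b) * NormedSpace.exp (θ • -b) = 1 := by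
    rw [smul_neg, ← NormedSpace.exp_add_of_commute (Commute.refl _).neg_right, add_neg_cancel,
      NormedSpace.exp_zero]
  calc NormedSpace.exp (θ • b) = NormedSpace.exp (θ • b) * (NormedSpace.exp (θ • -b) *
        (1 + Real.sin θ • b + (1 - Real.cos θ) • b ^ 2)) := by rw [hconst, mul_one]
    _ = _ := by rw [← mul_assoc, hinv, one_mul]

/-- A Euclidean space of even dimension carries an orthogonal complex structure. -/
theorem exists_complex_structure (V : Type*) [NormedAddCommGroup V] [InnerProductSpace ℝ V]
    [FiniteDimensional ℝ V] (h : Even (Module.finrank ℝ V)) :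
    ∃ J : V →L[ℝ] V, (∀ x y, inner ℝ (J x) y = -(inner ℝ x (J y) : ℝ)) ∧ ∀ x, J (J x) = -x := by
  obtain ⟨m, hm⟩ := h
  let φ := ((stdOrthonormalBasis ℝ V).reindex
    ((finCongr hm).trans finSumFinEquiv.symm)).repr
  let j : EuclideanSpace ℝ (Fin m ⊕ Fin m) →ₗ[ℝ] EuclideanSpace ℝ (Fin m ⊕ Fin m) :=
    { toFun := fun w => WithLp.toLp 2 (Sum.elim (fun k => -w (Sum.inr k)) fun k => w (Sum.inl k))
      map_add' := fun a b => by
        ext k; rcases k with k | k <;> simp [add_comm]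
      map_smul' := fun r a => by
        ext k; rcases k with k | k <;> simp }
  let J : V →ₗ[ℝ] V := φ.symm.toLinearEquiv.toLinearMap ∘ₗ j ∘ₗ φ.toLinearEquiv.toLinearMap
  have hφJ : ∀ x, φ (J x) = j (φ x) := fun x => φ.apply_symm_apply _
  refine ⟨J.toContinuousLinearMap, fun x y => ?_, fun x => ?_⟩
  · change inner ℝ (J x) y = -(inner ℝ x (J y) : ℝ)
    rw [← φ.inner_map_map, ← φ.inner_map_map x, hφJ, hφJ, PiLp.inner_apply, PiLp.inner_apply,
      Fintype.sum_sum_type, Fintype.sum_sum_type]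
    simp [j]
  · change J (J x) = -x
    apply φ.injective
    rw [hφJ, hφJ, map_neg]
    ext k; rcases k with k | k <;> simp [j]

section Defect
variable {ι H : Type*} [NormedAddCommGroup H] [InnerProductSpace ℝ H] [CompleteSpace H]

/-- The positive operator `½ (Q - 1)* (Q - 1)`, which equals `1 - ½ (Q + Q*)` for orthogonal `Q`;
its eigenvalues are the numbers `1 - cos θ`, where `θ` runs over the rotation angles of `Q`. -/
noncomputable def defect (Q : H →L[ℝ] H) : H →L[ℝ] H :=
  (1 / 2 : ℝ) • (ContinuousLinearMap.adjoint (Q - 1) * (Q - 1))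

/-- The eigenspace of the defect of `Q` for `μ`; it is `⊥` when `μ` is not an eigenvalue. -/
noncomputable def defectSpace (Q : H →L[ℝ] H) (μ : ℝ) : Submodule ℝ H :=
  Module.End.eigenspace (defect Q : H →ₗ[ℝ] H) μ

theorem mem_defectSpace {Q : H →L[ℝ] H} {μ : ℝ} {x : H} :
    x ∈ defectSpace Q μ ↔ defect Q x = μ • x :=
  Module.End.mem_eigenspace_iff

instance (Q : H →L[ℝ] H) (μ : ℝ) : CompleteSpace (defectSpace Q μ) := by
  have : IsClosed (defectSpace Q μ : Set H) := by
    have h : (defectSpace Q μ : Set H) = {x | defect Q x = μ • x} := by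
      ext x; exact mem_defectSpace
    rw [h]
    exact isClosed_eq (defect Q).continuous (continuous_const_smul μ)
  exact this.completeSpace_coe

theorem defect_apply (Q : H →L[ℝ] H) (x : H) :
    defect Q x = (1 / 2 : ℝ) • ContinuousLinearMap.adjoint (Q - 1) ((Q - 1) x) := rfl

theorem isSymmetric_defect (Q : H →L[ℝ] H) : (defect Q : H →ₗ[ℝ] H).IsSymmetric := by
  intro x y
  rw [ContinuousLinearMap.coe_coe, defect_apply, defect_apply, inner_smul_left, inner_smul_right,
    ContinuousLinearMap.adjoint_inner_left, ContinuousLinearMap.adjoint_inner_right, conj_trivial]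

theorem norm_sub_one_apply_sq (Q : H →L[ℝ] H) (x : H) :
    ‖(Q - 1) x‖ ^ 2 = 2 * inner ℝ x (defect Q x) := by
  rw [defect_apply, inner_smul_right, ContinuousLinearMap.adjoint_inner_right,
    real_inner_self_eq_norm_sq]
  ring

theorem norm_sub_one_apply_sq_of_mem {Q : H →L[ℝ] H} {μ : ℝ} {x : H}
    (hx : x ∈ defectSpace Q μ) : ‖(Q - 1) x‖ ^ 2 = 2 * μ * ‖x‖ ^ 2 := by
  rw [norm_sub_one_apply_sq, mem_defectSpace.mp hx, inner_smul_right, real_inner_self_eq_norm_sq]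
  ring

theorem isCompactOperator_defect {e : HilbertBasis ι ℝ H} {Q : H →L[ℝ] H}
    (hQ : IsHilbertSchmidt e (Q - 1)) : IsCompactOperator (defect Q) := by
  have h := hQ.isCompactOperator.clm_comp ((1 / 2 : ℝ) • ContinuousLinearMap.adjoint (Q - 1))
  have h2 : (defect Q : H → H) =
      ⇑((1 / 2 : ℝ) • ContinuousLinearMap.adjoint (Q - 1)) ∘ ⇑(Q - 1) :=
    funext fun x => defect_apply Q x
  rw [h2]
  exact h

theorem finiteDimensional_defectSpace {e : HilbertBasis ι ℝ H} {Q : H →L[ℝ] H}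
    (hQ : IsHilbertSchmidt e (Q - 1)) {μ : ℝ} (hμ : μ ≠ 0) :
    FiniteDimensional ℝ (defectSpace Q μ) :=
  ContinuousLinearMap.finite_dimensional_eigenspace (isCompactOperator_defect hQ) μ hμ

theorem defectSpace_isOrtho (Q : H →L[ℝ] H) {μ ν : ℝ} (h : μ ≠ ν) :
    defectSpace Q μ ⟂ defectSpace Q ν :=
  (isSymmetric_defect Q).orthogonalFamily_eigenspaces.isOrtho h

/-- The spectral theorem for the defect of `Q`, as a resolution of the identity. The sum runs over
all real `μ`, most of which contribute `0`. -/
theorem hasSum_starProjection_defectSpace {e : HilbertBasis ι ℝ H} {Q : H →L[ℝ] H}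
    (hQ : IsHilbertSchmidt e (Q - 1)) (x : H) :
    HasSum (fun μ => (defectSpace Q μ).starProjection x) x := by
  have hsum : IsHilbertSum ℝ (fun μ => defectSpace Q μ) fun μ => (defectSpace Q μ).subtypeₗᵢ := by
    refine IsHilbertSum.mkInternal _ (isSymmetric_defect Q).orthogonalFamily_eigenspaces ?_
    have h := ContinuousLinearMap.orthogonalComplement_iSup_eigenspaces_eq_bot
      (isCompactOperator_defect hQ) (isSymmetric_defect Q)
    exact (Submodule.topologicalClosure_eq_top_iff.mpr h).ge
  -- the components of `x` in the Hilbert sum are its projections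
  obtain ⟨w, hw⟩ : ∃ w : ∀ μ, defectSpace Q μ, HasSum (fun μ => (w μ : H)) x := by
    have := hsum.hasSum_linearIsometryEquiv_symm (hsum.linearIsometryEquiv x)
    rw [LinearIsometryEquiv.symm_apply_apply] at this
    exact ⟨_, this⟩
  refine hw.congr_fun fun ν => ?_
  have h1 := hw.mapL (defectSpace Q ν).starProjection
  refine h1.unique ?_
  have h2 := hasSum_single (f := fun μ => (defectSpace Q ν).starProjection (w μ : H)) ν
    fun μ hμ => by
      rw [Submodule.starProjection_apply_eq_zero_iff]
      exact (defectSpace_isOrtho Q hμ) (w μ).2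
  rwa [Submodule.starProjection_eq_self_iff.mpr (w ν).2] at h2

theorem defect_apply_of_mem_unitary {Q : H →L[ℝ] H} (hQ : Q ∈ unitary (H →L[ℝ] H)) (x : H) :
    defect Q x = x - (1 / 2 : ℝ) • (Q x + ContinuousLinearMap.adjoint Q x) := by
  have h : ContinuousLinearMap.adjoint Q (Q x) = x := DFunLike.congr_fun hQ.1 x
  have h1 : ContinuousLinearMap.adjoint (Q - 1) = ContinuousLinearMap.adjoint Q - 1 := by
    rw [map_sub, ← ContinuousLinearMap.star_eq_adjoint (1 : H →L[ℝ] H), star_one]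
  change (1 / 2 : ℝ) • (ContinuousLinearMap.adjoint (Q - 1) (Q x - x)) = _
  rw [h1]
  change (1 / 2 : ℝ) • (ContinuousLinearMap.adjoint Q (Q x - x) - (Q x - x)) = _
  rw [map_sub, h]
  module

theorem mem_defectSpace_iff_of_mem_unitary {Q : H →L[ℝ] H} (hQ : Q ∈ unitary (H →L[ℝ] H))
    {μ : ℝ} {x : H} :
    x ∈ defectSpace Q μ ↔ ContinuousLinearMap.adjoint Q x = (2 * (1 - μ)) • x - Q x := by
  rw [mem_defectSpace, defect_apply_of_mem_unitary hQ]
  constructor <;> intro h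
  · have := congrArg (fun y => (2 : ℝ) • (x - y) - Q x) h
    beta_reduce at this
    rw [show (2 : ℝ) • (x - (x - (1 / 2 : ℝ) • (Q x + ContinuousLinearMap.adjoint Q x))) - Q x =
      ContinuousLinearMap.adjoint Q x by module] at this
    rw [this]
    module
  · rw [h]; module

theorem apply_mem_defectSpace {Q : H →L[ℝ] H} (hQ : Q ∈ unitary (H →L[ℝ] H))
    {μ : ℝ} {x : H} (hx : x ∈ defectSpace Q μ) : Q x ∈ defectSpace Q μ := by
  rw [mem_defectSpace_iff_of_mem_unitary hQ] at hx ⊢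
  have h1 : ContinuousLinearMap.adjoint Q (Q x) = x := DFunLike.congr_fun hQ.1 x
  have h2 : Q (ContinuousLinearMap.adjoint Q x) = x := DFunLike.congr_fun hQ.2 x
  rw [hx, map_sub, map_smul] at h2
  rw [h1, h2]

theorem mem_defectSpace_two {Q : H →L[ℝ] H} (hQ : Q ∈ unitary (H →L[ℝ] H)) {x : H} :
    x ∈ defectSpace Q 2 ↔ Q x = -x := by
  rw [mem_defectSpace_iff_of_mem_unitary hQ]
  have h1 : ContinuousLinearMap.adjoint Q (Q x) = x := DFunLike.congr_fun hQ.1 x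
  constructor <;> intro h
  · have h2 : ‖Q x + x‖ ^ 2 = 0 := by
      rw [← real_inner_self_eq_norm_sq, inner_add_left,
        ← ContinuousLinearMap.adjoint_inner_right Q x, map_add, h1, h, ← inner_add_right]
      rw [show x + ((2 * (1 - 2 : ℝ)) • x - Q x) + (Q x + x) = 0 by module, inner_zero_right]
    exact eq_neg_of_add_eq_zero_left (by simpa using h2)
  · have h2 : ContinuousLinearMap.adjoint Q x = -x := by
      rw [h, map_neg] at h1
      rw [← h1, neg_neg, h1]
    rw [h2, h]; module

/-- On the eigenspace of the defect for `1 - cos θ`, the operator `Q` is `cos θ + sin θ B` for a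
skew `B` with `B² = -1` there; `B` is extended by `0` to the orthogonal complement. -/
theorem exists_rotation_generator {Q : H →L[ℝ] H} (hQ : Q ∈ unitary (H →L[ℝ] H)) {θ : ℝ}
    (h0 : 0 < θ) (hπ : θ ≤ Real.pi) [FiniteDimensional ℝ (defectSpace Q (1 - Real.cos θ))]
    (heven : θ = Real.pi → Even (Module.finrank ℝ (defectSpace Q (1 - Real.cos θ)))) :
    ∃ B : H →L[ℝ] H, ContinuousLinearMap.adjoint B = -B ∧
      B * B = -(defectSpace Q (1 - Real.cos θ)).starProjection ∧
      (defectSpace Q (1 - Real.cos θ)).starProjection * B = B ∧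
      B * (defectSpace Q (1 - Real.cos θ)).starProjection = B ∧
      Real.sin θ • B - (1 - Real.cos θ) • (defectSpace Q (1 - Real.cos θ)).starProjection =
        (Q - 1) * (defectSpace Q (1 - Real.cos θ)).starProjection := by
  set E := defectSpace Q (1 - Real.cos θ) with hE
  -- a skew `J` on `E` with `J² = -1` and `sin θ J = Q - cos θ` on `E`
  obtain ⟨J, hJ1, hJ2, hJ3⟩ : ∃ J : E →L[ℝ] E,
      (∀ x y, inner ℝ (J x) y = -(inner ℝ x (J y) : ℝ)) ∧ (∀ x, J (J x) = -x) ∧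
      ∀ x : E, Real.sin θ • (J x : H) = Q x - Real.cos θ • (x : H) := by
    rcases hπ.eq_or_lt with rfl | hlt
    · obtain ⟨J, hJ1, hJ2⟩ := exists_complex_structure E (heven rfl)
      refine ⟨J, hJ1, hJ2, fun x => ?_⟩
      have hx : Q x = -x := by
        rw [← mem_defectSpace_two hQ]
        have h2 : E = defectSpace Q 2 := by
          rw [hE, Real.cos_pi]; norm_num
        exact h2.le x.2
      rw [hx, Real.sin_pi, Real.cos_pi]
      module
    · have hs : Real.sin θ ≠ 0 := (Real.sin_pos_of_pos_of_lt_pi h0 hlt).ne'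
      have hQE : ∀ x ∈ E, Q x ∈ E := fun x hx => apply_mem_defectSpace hQ hx
      have hadj : ∀ x ∈ E,
          ContinuousLinearMap.adjoint Q x = (2 * Real.cos θ) • x - Q x := by
        intro x hx
        rw [hE, mem_defectSpace_iff_of_mem_unitary hQ] at hx
        rwa [sub_sub_cancel] at hx
      let J : E →L[ℝ] E := (Real.sin θ)⁻¹ • (Q.restrict hQE - Real.cos θ • 1)
      have hJ : ∀ x : E, (J x : H) = (Real.sin θ)⁻¹ • (Q x - Real.cos θ • (x : H)) := fun x => rfl
      refine ⟨J, fun x y => ?_, fun x => ?_, fun x => ?_⟩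
      · rw [Submodule.coe_inner, Submodule.coe_inner, hJ, hJ, inner_smul_left, inner_smul_right,
          inner_sub_left, inner_sub_right,
          ← ContinuousLinearMap.adjoint_inner_right Q (x : H) (y : H), hadj y y.2,
          inner_sub_right, inner_smul_right, inner_smul_left, inner_smul_right]
        simp only [conj_trivial]
        ring
      · apply Subtype.coe_injective
        have h2 : Q (Q x) = (2 * Real.cos θ) • Q x - (x : H) := by
          have h3 : Q (ContinuousLinearMap.adjoint Q (x : H)) = x :=
            DFunLike.congr_fun hQ.2 (x : H)
          rw [hadj x x.2, map_sub, map_smul] at h3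
          calc Q (Q x) = (2 * Real.cos θ) • Q x - ((2 * Real.cos θ) • Q x - Q (Q x)) := by module
            _ = _ := by rw [h3]
        change (J (J x) : H) = ((-x : E) : H)
        rw [hJ, hJ, map_smul, map_sub, map_smul, h2, Submodule.coe_neg]
        have h4 : Real.cos θ ^ 2 - 1 = -(Real.sin θ ^ 2) := by
          linarith [Real.sin_sq_add_cos_sq θ]
        calc _ = ((Real.sin θ)⁻¹ ^ 2 * (Real.cos θ ^ 2 - 1)) • (x : H) := by module
          _ = -(x : H) := by
            rw [h4, mul_neg, ← mul_pow, inv_mul_cancel₀ hs]; simp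
      · rw [hJ, smul_smul, mul_inv_cancel₀ hs, one_smul]
  let B : H →L[ℝ] H := E.subtypeL ∘L J ∘L E.orthogonalProjectionOnto
  have hB : ∀ x, B x = J (E.orthogonalProjectionOnto x) := fun x => rfl
  have hproj : ∀ y : E, E.orthogonalProjectionOnto (y : H) = y := fun y => by simp
  refine ⟨B, ?_, ?_, ?_, ?_, ?_⟩
  · rw [eq_comm, ContinuousLinearMap.eq_adjoint_iff]
    intro x y
    rw [neg_apply, inner_neg_left, hB, hB, ← E.inner_orthogonalProjectionOnto_eq_of_mem_left,
      ← E.inner_orthogonalProjectionOnto_eq_of_mem_right, hJ1, neg_neg]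
  · ext x
    change B (B x) = -(E.orthogonalProjectionOnto x : H)
    rw [hB x, hB, hproj, hJ2, Submodule.coe_neg]
  · ext x
    change E.starProjection (B x) = B x
    rw [Submodule.starProjection_eq_self_iff]
    exact (J _).2
  · ext x
    change B (E.orthogonalProjectionOnto x : H) = B x
    rw [hB, hproj, hB]
  · ext x
    change Real.sin θ • B x - (1 - Real.cos θ) • (E.orthogonalProjectionOnto x : H) =
      Q (E.orthogonalProjectionOnto x) - (E.orthogonalProjectionOnto x : H)
    rw [hB, hJ3]
    module

end Defect

/-! ### The decomposition into commuting rotations -/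

section Decomposition
variable {ι H : Type*} [NormedAddCommGroup H] [InnerProductSpace ℝ H] [CompleteSpace H]

theorem norm_sub_one_starProjection_apply_sq (Q : H →L[ℝ] H) (μ : ℝ) (x : H) :
    ‖((Q - 1) * (defectSpace Q μ).starProjection) x‖ ^ 2 =
      2 * μ * ‖(defectSpace Q μ).starProjection x‖ ^ 2 :=
  norm_sub_one_apply_sq_of_mem (Submodule.starProjection_apply_mem _ x)

theorem hasSum_norm_sq_sub_one_starProjection {e : HilbertBasis ι ℝ H} {Q : H →L[ℝ] H}
    (hQ : IsHilbertSchmidt e (Q - 1)) (μ : ℝ) :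
    HasSum (fun i => ‖((Q - 1) * (defectSpace Q μ).starProjection) (e i)‖ ^ 2)
      (2 * μ * Module.finrank ℝ (defectSpace Q μ)) := by
  simp only [norm_sub_one_starProjection_apply_sq]
  rcases eq_or_ne μ 0 with rfl | hμ
  · simp
  · have := finiteDimensional_defectSpace hQ hμ
    exact (hasSum_norm_sq_starProjection e (defectSpace Q μ)).mul_left _

theorem inner_sub_one_starProjection_apply {Q : H →L[ℝ] H} (hQ : Q ∈ unitary (H →L[ℝ] H))
    {μ ν : ℝ} (h : μ ≠ ν) (x : H) :
    inner ℝ (((Q - 1) * (defectSpace Q μ).starProjection) x)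
      (((Q - 1) * (defectSpace Q ν).starProjection) x) = (0 : ℝ) := by
  have hmem : ∀ μ, ((Q - 1) * (defectSpace Q μ).starProjection) x ∈ defectSpace Q μ := fun μ =>
    sub_mem (apply_mem_defectSpace hQ (Submodule.starProjection_apply_mem _ x))
      (Submodule.starProjection_apply_mem _ x)
  exact (defectSpace_isOrtho Q h).inner_eq (hmem μ) (hmem ν)

/-- The hypothesis holds for `μ = 0`, where `Q = 1` on the eigenspace, and when the eigenspace is
trivial. (An infinite-dimensional eigenspace, for which `finrank` is `0`, occurs only for
`μ = 0`.) -/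
theorem sub_one_starProjection_apply_eq_zero {e : HilbertBasis ι ℝ H} {Q : H →L[ℝ] H}
    (hQ : IsHilbertSchmidt e (Q - 1)) {μ : ℝ}
    (hμ : 2 * μ * (Module.finrank ℝ (defectSpace Q μ) : ℝ) = 0) (x : H) :
    (Q - 1) ((defectSpace Q μ).starProjection x) = 0 := by
  have h := norm_sub_one_starProjection_apply_sq Q μ x
  suffices h0 : μ = 0 ∨ (defectSpace Q μ).starProjection x = 0 by
    rcases h0 with h0 | h0
    · rw [h0] at h ⊢
      simpa using h
    · rw [h0, map_zero]
  by_cases hμ0 : μ = 0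
  · exact Or.inl hμ0
  · have := finiteDimensional_defectSpace hQ hμ0
    have hbot : defectSpace Q μ = ⊥ := by
      rw [← Submodule.finrank_eq_zero (R := ℝ)]
      simpa [hμ0] using hμ
    have hmem := Submodule.starProjection_apply_mem (defectSpace Q μ) x
    exact Or.inr ((Submodule.eq_bot_iff _).mp hbot _ hmem)

/-- The trace formula `∑ 2 μ n_μ = |Q - 1|²`. At `μ = 0` the possibly infinite multiplicity does not
matter, as the factor `μ` vanishes. -/
theorem hasSum_finrank_defectSpace {e : HilbertBasis ι ℝ H} {Q : H →L[ℝ] H}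
    (hQ : Q ∈ unitary (H →L[ℝ] H)) (hHS : IsHilbertSchmidt e (Q - 1)) :
    HasSum (fun μ => 2 * μ * (Module.finrank ℝ (defectSpace Q μ) : ℝ)) (hsNorm e (Q - 1) ^ 2) := by
  have h1 : ∀ i, HasSum
      (fun μ => ‖((Q - 1) * (defectSpace Q μ).starProjection) (e i)‖ ^ 2)
      (‖(Q - 1) (e i)‖ ^ 2) := fun i => by
    have h := (hasSum_starProjection_defectSpace hHS (e i)).mapL (Q - 1)
    exact h.norm_sq_of_pairwise_orthogonal fun _ _ h =>
      inner_sub_one_starProjection_apply hQ h (e i)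
  exact HasSum.swap_of_nonneg (fun _ _ => sq_nonneg _) h1 hHS.hasSum
    (hasSum_norm_sq_sub_one_starProjection hHS)

theorem pos_and_le_two_of_finrank_defectSpace_ne_zero {Q : H →L[ℝ] H}
    (hQ : Q ∈ unitary (H →L[ℝ] H)) {μ : ℝ}
    (h : 2 * μ * (Module.finrank ℝ (defectSpace Q μ) : ℝ) ≠ 0) : 0 < μ ∧ μ ≤ 2 := by
  have hf : Module.finrank ℝ (defectSpace Q μ) ≠ 0 := by
    rintro h0; simp [h0] at h
  have hμ : μ ≠ 0 := by
    rintro rfl; simp at h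
  have := Module.nontrivial_of_finrank_pos (Nat.pos_of_ne_zero hf)
  obtain ⟨⟨x, hx⟩, hx0⟩ := exists_ne (0 : defectSpace Q μ)
  have hx0 : 0 < ‖x‖ := by simpa using hx0
  have h1 := norm_sub_one_apply_sq_of_mem hx
  have h2 : ‖(Q - 1) x‖ ≤ 2 * ‖x‖ := by
    calc ‖(Q - 1) x‖ ≤ ‖Q x‖ + ‖x‖ := norm_sub_le _ _
      _ = 2 * ‖x‖ := by rw [norm_apply_of_mem_unitary hQ]; ring
  have h3 : 0 ≤ ‖(Q - 1) x‖ := norm_nonneg _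
  constructor
  · refine lt_of_le_of_ne ?_ hμ.symm
    by_contra hneg
    nlinarith [mul_pos (neg_pos.mpr (not_le.mp hneg)) (pow_pos hx0 2), sq_nonneg ‖(Q - 1) x‖]
  · have h4 : ‖(Q - 1) x‖ ^ 2 ≤ (2 * ‖x‖) ^ 2 := pow_le_pow_left₀ h3 h2 2
    rw [h1] at h4
    by_contra hgt
    nlinarith [mul_pos (sub_pos.mpr (not_le.mp hgt)) (pow_pos hx0 2)]

/-- The support of a summable family of reals is countable, hence indexed by a set of natural
numbers. -/
theorem exists_nat_index_of_summable {c : ℝ → ℝ} (hc : Summable c) :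
    ∃ (J : Set ℕ) (m : J → ℝ), Function.Injective m ∧ ∀ μ, μ ∈ Set.range m ↔ c μ ≠ 0 := by
  have := hc.countable_support.to_subtype
  obtain ⟨g, hg⟩ := exists_injective_nat (Function.support c)
  refine ⟨Set.range g, fun j => ((Equiv.ofInjective g hg).symm j : ℝ),
    Subtype.coe_injective.comp (Equiv.injective _), fun μ => ⟨?_, fun h => ?_⟩⟩
  · rintro ⟨j, rfl⟩
    exact ((Equiv.ofInjective g hg).symm j).2
  · exact ⟨Equiv.ofInjective g hg ⟨μ, h⟩, by simp⟩

theorem exp_sum_eq_one_add_sum {A α : Type*} [NormedRing A] [NormedAlgebra ℝ A] [CompleteSpace A]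
    {X T : α → A} (hX : ∀ j, NormedSpace.exp (X j) = 1 + T j) (hcomm : ∀ j k, Commute (X j) (X k))
    (hT : ∀ j k, j ≠ k → T j * T k = 0) (s : Finset α) :
    NormedSpace.exp (∑ j ∈ s, X j) = 1 + ∑ j ∈ s, T j := by
  classical
  let := NormedAlgebra.restrictScalars ℚ ℝ A
  induction s using Finset.induction_on with
  | empty => simp
  | insert a s ha ih =>
    rw [Finset.sum_insert ha, Finset.sum_insert ha, NormedSpace.exp_add_of_commute
      (Commute.sum_right _ _ _ fun k _ => hcomm a k), hX, ih]
    have h0 : T a * ∑ j ∈ s, T j = 0 := by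
      rw [Finset.mul_sum]
      exact Finset.sum_eq_zero fun k hk => hT a k fun h => ha (h ▸ hk)
    rw [add_mul, mul_add, mul_add, h0]
    simp only [one_mul, mul_one, add_zero]
    abel

theorem prod_map_one_add_eq_one_add_sum {A α : Type*} [Ring A] {T : α → A}
    (hT : ∀ j k, j ≠ k → T j * T k = 0) {l : List α} (hl : l.Nodup) :
    (l.map fun j => 1 + T j).prod = 1 + (l.map T).sum := by
  induction l with
  | nil => simp
  | cons a l ih =>
    rw [List.nodup_cons] at hl
    have h0 : T a * (l.map T).sum = 0 := by
      rw [← List.sum_map_mul_left]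
      refine List.sum_eq_zero fun x hx => ?_
      obtain ⟨k, hk, rfl⟩ := List.mem_map.mp hx
      exact hT a k fun h => hl.1 (h ▸ hk)
    rw [List.map_cons, List.prod_cons, List.map_cons, List.sum_cons, ih hl.2, add_mul, mul_add,
      mul_add, h0]
    simp only [one_mul, mul_one, add_zero]
    abel

/-- The decomposition of an orthogonal `Q` with `Q - 1` Hilbert-Schmidt into commuting rotations.
The only obstruction is the parity of the dimension of `ker (Q + 1)`, the eigenspace of the defect
for `2`. -/
theorem exists_rotation_decomposition {e : HilbertBasis ι ℝ H} {Q : H →L[ℝ] H}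
    (hQ : Q ∈ unitary (H →L[ℝ] H)) (hHS : IsHilbertSchmidt e (Q - 1))
    (heven : Even (Module.finrank ℝ (defectSpace Q 2))) :
    ∃ (J : Set ℕ) (θ : J → ℝ) (B : J → (H →L[ℝ] H)) (S : H →L[ℝ] H),
      (∀ j, 0 < θ j ∧ θ j ≤ Real.pi) ∧
      (∀ j, B j ∈ soHS e) ∧
      (∀ k j, k ≠ j → ⁅B k, B j⁆ = 0) ∧
      (∀ j, B j ^ 3 = -B j) ∧
      S ∈ soHS e ∧
      HSTendsto e (fun s : Finset J => ∑ j ∈ s, θ j • B j) atTop S ∧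
      HSTendsto e
        (fun s : Finset J => ((s.sort (· ≤ ·)).map fun j => NormedSpace.exp (θ j • B j)).prod)
        atTop Q ∧
      Q = NormedSpace.exp S ∧
      (∀ j, FiniteDimensional ℝ (B j).range) ∧
      HasSum (fun j => (Module.finrank ℝ (B j).range : ℝ) * θ j ^ 2) (hsNorm e S ^ 2) := by
  have hc := (hasSum_finrank_defectSpace hQ hHS).summable
  obtain ⟨J, m, hm_inj, hm⟩ := exists_nat_index_of_summable hc
  have hm_pos : ∀ j, 0 < m j ∧ m j ≤ 2 := fun j =>
    pos_and_le_two_of_finrank_defectSpace_ne_zero hQ ((hm (m j)).mp ⟨j, rfl⟩)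
  have hθ : ∀ j, ∃ θ : ℝ, 0 < θ ∧ θ ≤ Real.pi ∧ m j = 1 - Real.cos θ := fun j =>
    ⟨Real.arccos (1 - m j), Real.arccos_pos.mpr (by linarith [(hm_pos j).1]), Real.arccos_le_pi _,
      by rw [Real.cos_arccos (by linarith [(hm_pos j).2]) (by linarith [(hm_pos j).1])]; ring⟩
  choose θ hθ0 hθπ hmθ using hθ
  set E : J → Submodule ℝ H := fun j => defectSpace Q (1 - Real.cos (θ j)) with hE
  have hEfin : ∀ j, FiniteDimensional ℝ (E j) := fun j =>
    finiteDimensional_defectSpace hHS (by rw [← hmθ]; exact (hm_pos j).1.ne')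
  have hgen : ∀ j, ∃ B : H →L[ℝ] H, ContinuousLinearMap.adjoint B = -B ∧
      B * B = -(E j).starProjection ∧ (E j).starProjection * B = B ∧
      B * (E j).starProjection = B ∧
      Real.sin (θ j) • B - (1 - Real.cos (θ j)) • (E j).starProjection =
        (Q - 1) * (E j).starProjection := fun j => by
    refine exists_rotation_generator hQ (hθ0 j) (hθπ j) fun h => ?_
    rw [h, Real.cos_pi, show (1 : ℝ) - -1 = 2 by norm_num]
    exact heven
  choose B hBadj hBB hPB hBP hBQ using hgen
  set T : J → H →L[ℝ] H := fun j => (Q - 1) * (E j).starProjection with hTdef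
  have hEne : ∀ j k, j ≠ k → (1 - Real.cos (θ j)) ≠ 1 - Real.cos (θ k) := fun j k hjk => by
    rw [← hmθ, ← hmθ]; exact hm_inj.ne hjk
  have hPP : ∀ j k, j ≠ k → (E j).starProjection * (E k).starProjection = 0 := fun j k hjk =>
    (defectSpace_isOrtho Q (hEne j k hjk)).starProjection_comp_starProjection
  have hBB0 : ∀ j k, j ≠ k → B j * B k = 0 := fun j k hjk => by
    rw [← hBP j, ← hPB k, mul_assoc, ← mul_assoc (E j).starProjection, hPP j k hjk]; simp
  have hB3 : ∀ j, B j ^ 3 = -B j := fun j => by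
    rw [pow_succ, sq, hBB, neg_mul, hPB]
  have hBnorm : ∀ j x, ‖B j x‖ ^ 2 = ‖(E j).starProjection x‖ ^ 2 := by
    intro j x
    have h1 : B j (B j x) = -(E j).starProjection x := DFunLike.congr_fun (hBB j) x
    have h2 : inner ℝ x ((E j).starProjection x) = ‖(E j).starProjection x‖ ^ 2 := by
      rw [← real_inner_self_eq_norm_sq, (E j).inner_starProjection_left_eq_right,
        Submodule.starProjection_eq_self_iff.mpr (Submodule.starProjection_apply_mem _ x)]
    rw [← real_inner_self_eq_norm_sq, ← ContinuousLinearMap.adjoint_inner_right, hBadj, neg_apply,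
      h1, neg_neg, h2]
  have hexp : ∀ j, NormedSpace.exp (θ j • B j) = 1 + T j := fun j => by
    rw [exp_smul_of_pow_three_eq_neg (hB3 j), sq, hBB, hTdef]
    beta_reduce
    rw [← hBQ]
    module
  have hTT : ∀ j k, j ≠ k → T j * T k = 0 := by
    intro j k hjk
    have h1 : T k = (E k).starProjection * T k := by
      rw [hTdef]
      beta_reduce
      rw [← hBQ, mul_sub, mul_smul_comm, hPB, mul_smul_comm,
        (Submodule.isIdempotentElem_starProjection (E k)).eq]
    rw [h1, ← mul_assoc, hTdef]
    beta_reduce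
    rw [mul_assoc (Q - 1), hPP j k hjk]; simp
  have hcomm : ∀ j k, Commute (θ j • B j) (θ k • B k) := by
    intro j k
    rcases eq_or_ne j k with rfl | hjk
    · exact Commute.refl _
    · have h : Commute (B j) (B k) := (hBB0 j k hjk).trans (hBB0 k j hjk.symm).symm
      exact (h.smul_left _).smul_right _
  have hBsum : ∀ j, HasSum (fun i => ‖B j (e i)‖ ^ 2) (Module.finrank ℝ (E j) : ℝ) := fun j => by
    simp only [hBnorm]
    exact hasSum_norm_sq_starProjection e (E j)
  have hcJ : Summable fun j => 2 * m j * (Module.finrank ℝ (E j) : ℝ) := by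
    have := hc.comp_injective hm_inj
    refine this.congr fun j => ?_
    rw [Function.comp_apply, hE]
    beta_reduce
    rw [← hmθ]
  -- `θ² ≤ (π² / 2) (1 - cos θ)` on `[0, π]`
  have hθsum : Summable fun j => (Module.finrank ℝ (E j) : ℝ) * θ j ^ 2 := by
    refine Summable.of_nonneg_of_le (fun j => by positivity) (fun j => ?_)
      (hcJ.mul_left (Real.pi ^ 2 / 4))
    have h1 := Real.cos_le_one_sub_mul_cos_sq (x := θ j)
      (by rw [abs_of_pos (hθ0 j)]; exact hθπ j)
    have h2 : θ j ^ 2 ≤ Real.pi ^ 2 / 2 * m j := by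
      have hpi := Real.pi_pos
      rw [hmθ]
      have h3 : 2 / Real.pi ^ 2 * θ j ^ 2 ≤ 1 - Real.cos (θ j) := by linarith
      calc θ j ^ 2 = Real.pi ^ 2 / 2 * (2 / Real.pi ^ 2 * θ j ^ 2) := by field_simp
        _ ≤ _ := by gcongr
    calc (Module.finrank ℝ (E j) : ℝ) * θ j ^ 2
        ≤ (Module.finrank ℝ (E j) : ℝ) * (Real.pi ^ 2 / 2 * m j) := by gcongr
      _ = _ := by ring
  have hrange : ∀ j, (B j).range = E j := by
    intro j
    ext x
    constructor
    · rintro ⟨y, rfl⟩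
      have : (E j).starProjection (B j y) = B j y := DFunLike.congr_fun (hPB j) y
      exact Submodule.starProjection_eq_self_iff.mp this
    · intro hx
      refine ⟨-B j x, ?_⟩
      have h1 : B j (B j x) = -(E j).starProjection x := DFunLike.congr_fun (hBB j) x
      change B j (-B j x) = x
      rw [map_neg, h1, neg_neg, Submodule.starProjection_eq_self_iff.mpr hx]
  obtain ⟨S, hS1, hS2, hS3, -⟩ := exists_hsTendsto_sum_of_orthogonal e (fun j => θ j • B j)
    (c := fun j => (Module.finrank ℝ (E j) : ℝ) * θ j ^ 2)
    (fun x j k hjk => by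
      have h1 : B j (B k x) = 0 := DFunLike.congr_fun (hBB0 j k hjk) x
      beta_reduce
      rw [smul_apply, smul_apply, inner_smul_left, inner_smul_right,
        ← ContinuousLinearMap.adjoint_inner_right, hBadj, neg_apply, h1]
      simp)
    (fun j => by
      refine ((hBsum j).mul_right (θ j ^ 2)).congr_fun fun i => ?_
      rw [smul_apply, norm_smul, mul_pow, Real.norm_eq_abs, sq_abs, mul_comm])
    hθsum
  obtain ⟨S', hS'1, -, -, hS'2⟩ := exists_hsTendsto_sum_of_orthogonal e T
    (c := fun j => 2 * m j * (Module.finrank ℝ (E j) : ℝ))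
    (fun x j k hjk => inner_sub_one_starProjection_apply hQ (hEne j k hjk) x)
    (fun j => by
      rw [hmθ]
      exact hasSum_norm_sq_sub_one_starProjection hHS _)
    hcJ
  -- reindexing by `J` drops only the `μ` with `(Q - 1) P_μ = 0`
  have hS'Q : S' = Q - 1 := by
    ext x
    have h1 := (hasSum_starProjection_defectSpace hHS x).mapL (Q - 1)
    rw [← hm_inj.hasSum_iff] at h1
    · refine (hS'2 x).unique (h1.congr_fun fun j => ?_)
      simp only [Function.comp_apply, hmθ]
      rfl
    · intro μ hμ
      rw [hm, not_not] at hμ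
      exact sub_one_starProjection_apply_eq_zero hHS hμ x
  have hprod : ∀ s : Finset J,
      ((s.sort (· ≤ ·)).map fun j => NormedSpace.exp (θ j • B j)).prod = 1 + ∑ j ∈ s, T j := by
    intro s
    simp only [hexp]
    rw [prod_map_one_add_eq_one_add_sum hTT (Finset.sort_nodup s _)]
    congr 1
    rw [← Multiset.sum_coe, ← Multiset.map_coe, Finset.sort_eq]
    rfl
  refine ⟨J, θ, B, S, fun j => ⟨hθ0 j, hθπ j⟩, fun j => ⟨(hBsum j).summable, hBadj j⟩, ?_, hB3,
    ⟨hS2, ?_⟩, hS1, ?_, ?_, ?_, ?_⟩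
  · intro k j hkj
    rw [Ring.lie_def, hBB0 k j hkj, hBB0 j k hkj.symm, sub_zero]
  · have h1 := hS1.tendsto
    have h2 := ((ContinuousLinearMap.adjoint (𝕜 := ℝ) (E := H) (F := H)).continuous.tendsto S).comp
      h1
    refine tendsto_nhds_unique h2 (h1.neg.congr fun s => ?_)
    rw [Function.comp_apply, map_sum, ← Finset.sum_neg_distrib]
    exact Finset.sum_congr rfl fun j _ => (adjoint_smul_eq_neg (hBadj j) _).symm
  · have h : ∀ s : Finset J,
        ((s.sort (· ≤ ·)).map fun j => NormedSpace.exp (θ j • B j)).prod - Q =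
          ∑ j ∈ s, T j - S' := fun s => by
      rw [hprod, hS'Q]; abel
    simpa only [HSTendsto, h] using hS'1
  · let := NormedAlgebra.restrictScalars ℚ ℝ (H →L[ℝ] H)
    have h1 := (NormedSpace.exp_continuous.tendsto S).comp hS1.tendsto
    have h2 := hS'1.tendsto.const_add 1
    rw [hS'Q, add_sub_cancel] at h2
    refine tendsto_nhds_unique h2 (h1.congr fun s => ?_)
    exact exp_sum_eq_one_add_sum hexp hcomm hTT s
  · intro j
    rw [hrange]
    exact hEfin j
  · refine hS3.congr_fun fun j => ?_
    rw [hrange]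

/-- If `det Q = 1`, the eigenspace of `Q` for `-1` has even dimension. -/
theorem even_finrank_defectSpace_two [Nonempty ι] [LinearOrder ι] [LocallyFiniteOrderBot ι]
    {e : HilbertBasis ι ℝ H} {Q : H →L[ℝ] H} (hQ : Q ∈ SOHS e) :
    Even (Module.finrank ℝ (defectSpace Q 2)) := by
  obtain ⟨hU, hHS, hdet⟩ := hQ
  by_contra hodd
  rw [Nat.not_even_iff_odd] at hodd
  have hfin : FiniteDimensional ℝ (defectSpace Q 2) :=
    finiteDimensional_defectSpace hHS two_ne_zero
  have := Module.nontrivial_of_finrank_pos hodd.pos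
  obtain ⟨⟨v, hvE⟩, hv⟩ := exists_norm_eq (defectSpace Q 2) zero_le_one
  have hv : ‖v‖ = 1 := hv
  have hQv : Q v = -v := (mem_defectSpace_two hU).mp hvE
  set R := hyperplaneReflection v with hR
  have hRU : R ∈ unitary (H →L[ℝ] H) := hyperplaneReflection_mem_unitary hv
  have hRHS : IsHilbertSchmidt e (R - 1) := isHilbertSchmidt_hyperplaneReflection_sub_one e v
  have hU' : Q * R ∈ unitary (H →L[ℝ] H) := mul_mem hU hRU
  have hHS' : IsHilbertSchmidt e (Q * R - 1) := by
    have h := (hRHS.mul_left Q).add hHS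
    rwa [mul_sub, mul_one, sub_add_sub_cancel] at h
  have hQR : ∀ x, (Q * R) x = Q x + (2 * inner ℝ v x : ℝ) • v := by
    intro x
    change Q (R x) = _
    rw [hR, hyperplaneReflection_apply, map_sub, map_smul, hQv]
    module
  -- `Q * R` fixes `v`, so its eigenvectors for `-1` are orthogonal to `v`
  have hspace : defectSpace (Q * R) 2 = (ℝ ∙ v)ᗮ ⊓ defectSpace Q 2 := by
    ext x
    rw [Submodule.mem_inf, mem_defectSpace_two hU', mem_defectSpace_two hU,
      Submodule.mem_orthogonal_singleton_iff_inner_right, hQR]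
    constructor
    · intro h
      have h1 : inner ℝ (Q v) (Q x) = (inner ℝ v x : ℝ) :=
        ContinuousLinearMap.inner_map_map_of_mem_unitary hU v x
      have h2 := congrArg (fun y => (inner ℝ v y : ℝ)) h
      simp only [inner_add_right, inner_smul_right, real_inner_self_eq_norm_sq, hv,
        inner_neg_right] at h2
      rw [hQv, inner_neg_left] at h1
      have h3 : inner ℝ v x = (0 : ℝ) := by linarith
      refine ⟨h3, ?_⟩
      simpa [h3] using h
    · rintro ⟨h1, h2⟩
      rw [h1, h2]; simp
  have hrank := Submodule.finrank_add_inf_finrank_orthogonal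
    ((Submodule.span_singleton_le_iff_mem v _).mpr hvE)
  rw [← hspace, finrank_span_singleton (by rintro rfl; simp at hv)] at hrank
  have heven : Even (Module.finrank ℝ (defectSpace (Q * R) 2)) := by
    rw [← hrank, add_comm] at hodd
    exact Nat.not_odd_iff_even.mp fun h => Nat.not_odd_iff_even.mpr (h.add_odd odd_one) hodd
  obtain ⟨-, -, -, S, -, -, -, -, hS, -, -, hexp, -⟩ :=
    exists_rotation_decomposition hU' hHS' heven
  have hQS : Q = NormedSpace.exp S * R := by
    rw [← hexp, mul_assoc, hR, hyperplaneReflection_mul_self hv, mul_one]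
  have hneg := (hasHSDet_hyperplaneReflection e hv).exp_mul hS hRU hRHS
  rw [← hR, ← hQS] at hneg
  have := tendsto_nhds_unique hdet hneg
  norm_num at this

end Decomposition

/-! ### The exponential map of the Hilbert-Schmidt orthogonal group -/

theorem propositionP {ι H : Type*} [NormedAddCommGroup H] [InnerProductSpace ℝ H]
    [CompleteSpace H] [Nonempty ι] [LinearOrder ι] [LocallyFiniteOrderBot ι]
    (e : HilbertBasis ι ℝ H) :
    Set.MapsTo (NormedSpace.exp : (H →L[ℝ] H) → (H →L[ℝ] H)) (soHS e) (SOHS e) ∧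
    Set.SurjOn (NormedSpace.exp : (H →L[ℝ] H) → (H →L[ℝ] H)) (soHS e) (SOHS e) ∧
    ∀ Q ∈ SOHS e, ∃ (J : Set ℕ) (θ : J → ℝ) (B : J → (H →L[ℝ] H)) (S : H →L[ℝ] H),
      (∀ j, 0 < θ j ∧ θ j ≤ Real.pi) ∧
      (∀ j, B j ∈ soHS e) ∧
      (∀ k j, k ≠ j → ⁅B k, B j⁆ = 0) ∧
      (∀ j, B j ^ 3 = -B j) ∧
      -- the sum `S = ∑ θ_j B_j` converges unconditionally in the Hilbert-Schmidt norm
      S ∈ soHS e ∧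
      HSTendsto e (fun s : Finset J => ∑ j ∈ s, θ j • B j) atTop S ∧
      -- so does the product `Q = ∏ Exp (θ_j B_j)` (finite products in increasing order of `j`)
      HSTendsto e
        (fun s : Finset J => ((s.sort (· ≤ ·)).map fun j => NormedSpace.exp (θ j • B j)).prod)
        atTop Q ∧
      Q = NormedSpace.exp S ∧
      -- the ranks `n_j` are finite and `|S|_HS ^ 2 = ∑ n_j θ_j ^ 2`
      (∀ j, FiniteDimensional ℝ (B j).range) ∧
      HasSum (fun j => (Module.finrank ℝ (B j).range : ℝ) * θ j ^ 2) (hsNorm e S ^ 2) := by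
  have key := fun Q (hQ : Q ∈ SOHS e) =>
    exists_rotation_decomposition hQ.1 hQ.2.1 (even_finrank_defectSpace_two hQ)
  refine ⟨fun B hB => exp_mem_SOHS hB, fun Q hQ => ?_, key⟩
  obtain ⟨-, -, -, S, -, -, -, -, hS, -, -, hexp, -⟩ := key Q hQ
  exact ⟨S, hS, hexp.symm⟩
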